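/- For $s,d\in\mathbb{N}^+=\{1,2,3,\dots\}$ let $C^s([0,1]^d)$ be the set of functions $f:[0,1]^d\to\mathbb{R}$ all of whose partial derivatives of order at most $s$ exist (one-sided at the boundary) and are continuous on $[0,1]^d$, with the norm $$\|f\|_{C^s([0,1]^d)}=\max\big\{\|\partial^{\boldsymbol\alpha}f\|_{L^\infty([0,1]^d)}:\ \boldsymbol\alpha\in\mathbb{N}^d,\ \|\boldsymbol\alpha\|_1\le s\big\}.$$ A function $\phi:\mathbb{R}^d\to\mathbb{R}$ is implemented by a ReLU feed-forward neural network (FNN) of width $w$ and depth $\ell$, where $w,\ell\ge 0$ are real numbers, if $\phi=\mathcal{L}_k\circ\sigma\circ\mathcal{L}_{k-1}\circ\sigma\circ\cdots\circ\sigma\circ\mathcal{L}_0$ with affine maps $\mathcal{L}_i:\mathbb{R}^{N_i}\to\mathbb{R}^{N_{i+1}}$, $N_0=d$, $N_{k+1}=1$, where $\sigma(x)=\max\{0,x\}$ acts coordinatewise, the number $k$ of hidden layers is at most $\ell$, and every hidden layer has width $N_1,\dots,N_k\le w$. **Theorem.** Let $s,d\in\mathbb{N}^+$ and $f\in C^s([0,1]^d)$.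 For any $N,L\in\mathbb{N}^+$ there exists a function $\phi$ implemented by a ReLU FNN of width $C_1(N+2)\log_2(8N)$ and depth $C_2(L+2)\log_2(4L)+2d$ such that $$|\phi(\boldsymbol{x})-f(\boldsymbol{x})|\le C_3\,\|f\|_{C^s([0,1]^d)}\,N^{-2s/d}L^{-2s/d}\qquad\text{for all }\boldsymbol{x}\in[0,1]^d,$$ where $C_1=17s^{d+1}3^d d$, $C_2=18s^2$ and $C_3=85(s+1)^d8^s$. -/

import Mathlib

open MeasureTheory
open scoped ENNReal Matrix

namespace ReLUApprox

/-- The closed unit cube `[0,1]^d`. -/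
def unitCube (d : ℕ) : Set (Fin d → ℝ) := Set.Icc 0 1

/-- The partial derivative `∂g/∂x_i` on the unit cube (one-sided on its boundary): the derivative of
`t ↦ g (x + t e_i)` at `t = 0` within the set of those `t` for which `x + t e_i` is in the cube. -/
noncomputable def partialDeriv {d : ℕ} (i : Fin d) (g : (Fin d → ℝ) → ℝ) : (Fin d → ℝ) → ℝ :=
  fun x => lineDerivWithin ℝ g (unitCube d) x (Pi.single i 1)

/-- The mixed partial derivative `∂^α = ∂_1^{α_1} ∂_2^{α_2} ⋯ ∂_d^{α_d}` on the unit cube. -/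
noncomputable def mixedDeriv {d : ℕ} (α : Fin d → ℕ) (f : (Fin d → ℝ) → ℝ) : (Fin d → ℝ) → ℝ :=
  (List.finRange d).foldr (fun i g => (partialDeriv i)^[α i] g) f

/-- The norm of `L^∞([0,1]^d)`: the essential supremum of `|g|` over the cube, with respect to
Lebesgue measure. -/
noncomputable def linftyNorm {d : ℕ} (g : (Fin d → ℝ) → ℝ) : ℝ :=
  (eLpNorm g ∞ (volume.restrict (unitCube d))).toReal

/-- The norm of `C^s([0,1]^d)`: the maximum of `‖∂^α f‖_{L^∞([0,1]^d)}` over the (finitely many)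
multi-indices `α` with `|α| ≤ s`. -/
noncomputable def csNorm {d : ℕ} (s : ℕ) (f : (Fin d → ℝ) → ℝ) : ℝ :=
  ⨆ α : {α : Fin d → ℕ // ∑ i, α i ≤ s}, linftyNorm (mixedDeriv α.1 f)

/-- The rectified linear unit, applied to each coordinate. -/
def relu {n : ℕ} (v : Fin n → ℝ) : Fin n → ℝ := fun i => max 0 (v i)

/-- A fully connected ReLU network with `m` inputs, `k` outputs and hidden layers of the widths
listed: a weight matrix and a bias vector for each of its affine maps. -/
inductive ReLUNet (k : ℕ) : ℕ → List ℕ → Type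
  /-- No hidden layer is left: the last affine map. -/
  | output {m : ℕ} (W : Matrix (Fin k) (Fin m) ℝ) (b : Fin k → ℝ) : ReLUNet k m []
  /-- An affine map into a hidden layer of width `n`, followed by the rest of the network. -/
  | hidden {m n : ℕ} {ws : List ℕ} (W : Matrix (Fin n) (Fin m) ℝ) (b : Fin n → ℝ)
      (rest : ReLUNet k n ws) : ReLUNet k m (n :: ws)

/-- The function computed by a network: the activation acts on the hidden layers only. -/
def ReLUNet.eval {k : ℕ} : {m : ℕ} → {ws : List ℕ} → ReLUNet k m ws → (Fin m → ℝ) → (Fin k → ℝ)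
  | _, _, .output W b, x => W *ᵥ x + b
  | _, _, .hidden W b rest, x => rest.eval (relu (W *ᵥ x + b))

/-- `φ : ℝ^d → ℝ` is implemented by a ReLU network of width `width` and depth `depth`: every hidden
layer has at most `width` nodes, and there are at most `depth` hidden layers. -/
def IsImplementedBy {d : ℕ} (φ : (Fin d → ℝ) → ℝ) (width depth : ℝ) : Prop :=
  ∃ (ws : List ℕ) (net : ReLUNet 1 d ws),
    (∀ n ∈ ws, (n : ℝ) ≤ width) ∧ (ws.length : ℝ) ≤ depth ∧ ∀ x, φ x = net.eval x 0

end ReLUApprox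

/-! Divide the cube into `K ^ d ≤ (N * L) ^ 2` cells with `8 * K ≥ (N * L) ^ (2 / d)`. On a cell,
the Taylor polynomial of degree below `s` at the lower corner misses `f` by at most `(s + 1) ^ d *
‖f‖ * K ^ (-s)`, which is the desired rate (`exists_taylor`, `exists_mesh`). It remains to evaluate
this piecewise polynomial with a small network.

The cell index is read off by steep continuous steps, correct except on thin slabs beside the faces
(`HasDigits`). Monomials in the local coordinate come from a fast approximation of the square
(`exists_square`, `exists_monomial`).

The crux is to recall `(N * L) ^ 2` coefficients with width about `N` and depth about `L`. Each
coefficient is scaled to `[0,1]` and cut off after logarithmically many binary digits. One bit plane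
is a table of `N * N * L` words of `L` bits: the weights between two layers of size about `N` hold
`N * N` numbers, `L` such blocks follow each other, and `L` doubling steps extract a bit
(`exists_bit_memory`). A bit `b` times `g ∈ [0,1]` is exactly `max 0 (b + g - 1)`, so summing over
digits multiplies a coefficient by a monomial (`exists_coefficient_mul`). Digits spread partly over
width, partly over depth, produce the two logarithmic factors.

Finally the slabs are removed (`exists_extension`). Among three small shifts of a coordinate at most
one meets a slab, so the median of the three values is still accurate. Doing this for every
coordinate costs the factor `3 ^ d` in width and `2 * d` layers; continuity of `f` makes the shifts
harmless. -/

namespace ReLUApprox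

/-! ### Affine maps between real vector spaces -/

section Affine

variable {E F G : Type} [AddCommGroup E] [Module ℝ E] [AddCommGroup F] [Module ℝ F]
  [AddCommGroup G] [Module ℝ G]

/-- A map between real vector spaces is affine. -/
@[fun_prop]
def IsAff (f : E → F) : Prop := ∃ A : E →ᵃ[ℝ] F, ⇑A = f

@[fun_prop]
theorem isAff_id : IsAff (fun x : E => x) := ⟨AffineMap.id ℝ E, rfl⟩

@[fun_prop]
theorem isAff_const (c : F) : IsAff (fun _ : E => c) := ⟨AffineMap.const ℝ E c, rfl⟩

@[fun_prop]
theorem IsAff.comp {g : F → G} {f : E → F} (hg : IsAff g) (hf : IsAff f) :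
    IsAff (fun x => g (f x)) := by
  obtain ⟨A, rfl⟩ := hg
  obtain ⟨B, rfl⟩ := hf
  exact ⟨A.comp B, rfl⟩

theorem IsAff.of_linear (A : E →ₗ[ℝ] F) : IsAff (fun x => A x) := ⟨A.toAffineMap, rfl⟩

@[fun_prop]
theorem IsAff.fst {f : E → F × G} (hf : IsAff f) : IsAff (fun x => (f x).1) :=
  (IsAff.of_linear (LinearMap.fst ℝ F G)).comp hf

@[fun_prop]
theorem IsAff.snd {f : E → F × G} (hf : IsAff f) : IsAff (fun x => (f x).2) :=
  (IsAff.of_linear (LinearMap.snd ℝ F G)).comp hf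

@[fun_prop]
theorem IsAff.prodMk {f : E → F} {g : E → G} (hf : IsAff f) (hg : IsAff g) :
    IsAff (fun x => (f x, g x)) := by
  obtain ⟨A, rfl⟩ := hf
  obtain ⟨B, rfl⟩ := hg
  exact ⟨A.prod B, rfl⟩

@[fun_prop]
theorem isAff_apply {ι : Type} (i : ι) : IsAff (fun x : ι → F => x i) :=
  IsAff.of_linear (LinearMap.proj (R := ℝ) (φ := fun _ : ι => F) i)

@[fun_prop]
theorem IsAff.pi {ι : Type} {f : E → ι → F} (hf : ∀ i, IsAff (fun x => f x i)) : IsAff f := by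
  choose A hA using hf
  exact ⟨AffineMap.pi A, by ext x i; exact congrFun (hA i) x⟩

@[fun_prop]
theorem IsAff.add {f g : E → F} (hf : IsAff f) (hg : IsAff g) : IsAff (fun x => f x + g x) := by
  obtain ⟨A, rfl⟩ := hf
  obtain ⟨B, rfl⟩ := hg
  exact ⟨A + B, rfl⟩

@[fun_prop]
theorem IsAff.neg {f : E → F} (hf : IsAff f) : IsAff (fun x => -f x) := by
  obtain ⟨A, rfl⟩ := hf
  exact ⟨-A, rfl⟩

@[fun_prop]
theorem IsAff.sub {f g : E → F} (hf : IsAff f) (hg : IsAff g) : IsAff (fun x => f x - g x) := by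
  obtain ⟨A, rfl⟩ := hf
  obtain ⟨B, rfl⟩ := hg
  exact ⟨A - B, rfl⟩

@[fun_prop]
theorem IsAff.const_smul (c : ℝ) {f : E → F} (hf : IsAff f) : IsAff (fun x => c • f x) := by
  obtain ⟨A, rfl⟩ := hf
  exact ⟨c • A, rfl⟩

@[fun_prop]
theorem IsAff.const_mul (c : ℝ) {f : E → ℝ} (hf : IsAff f) : IsAff (fun x => c * f x) :=
  hf.const_smul c

@[fun_prop]
theorem IsAff.mul_const (c : ℝ) {f : E → ℝ} (hf : IsAff f) : IsAff (fun x => f x * c) := by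
  simpa only [mul_comm] using hf.const_mul c

@[fun_prop]
theorem IsAff.div_const (c : ℝ) {f : E → ℝ} (hf : IsAff f) : IsAff (fun x => f x / c) := by
  simpa only [div_eq_mul_inv] using hf.mul_const c⁻¹

@[fun_prop]
theorem IsAff.sum {ι : Type} (S : Finset ι) {f : ι → E → F} (hf : ∀ i, IsAff (f i)) :
    IsAff (fun x => ∑ i ∈ S, f i x) := by
  classical
  induction S using Finset.induction_on with
  | empty => simpa using isAff_const (E := E) (0 : F)
  | insert a S ha ih => simpa only [Finset.sum_insert ha] using (hf a).add ih

end Affine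

/-- `NN w ℓ f`: the map `f` is computed by a ReLU network with exactly `ℓ` hidden layers, each of
width at most `w`. -/
def NN (w : ℕ) : ℕ → ∀ {E F : Type} [AddCommGroup E] [Module ℝ E] [AddCommGroup F] [Module ℝ F],
    (E → F) → Prop
  | 0, _, _, _, _, _, _, f => IsAff f
  | ℓ + 1, E, F, _, _, _, _, f => ∃ n : ℕ, n ≤ w ∧ ∃ A : E → (Fin n → ℝ), IsAff A ∧
      ∃ g : (Fin n → ℝ) → F, NN w ℓ g ∧ ∀ x, f x = g (relu (A x))

/-! ### Serial and parallel composition of networks -/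

section Calculus

variable {E F G H : Type} [AddCommGroup E] [Module ℝ E] [AddCommGroup F] [Module ℝ F]
  [AddCommGroup G] [Module ℝ G] [AddCommGroup H] [Module ℝ H] {w w₁ w₂ ℓ ℓ₁ ℓ₂ : ℕ}

theorem NN.of_isAff {f : E → F} (hf : IsAff f) : NN w 0 f := hf

theorem NN.mono {f : E → F} (h : NN w₁ ℓ f) (hw : w₁ ≤ w₂) : NN w₂ ℓ f := by
  induction ℓ generalizing E with
  | zero => exact h
  | succ ℓ ih =>
    obtain ⟨n, hn, A, hA, g, hg, hf⟩ := h
    exact ⟨n, hn.trans hw, A, hA, g, ih hg, hf⟩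

theorem NN.comp_isAff {f : E → F} {g : F → G} (hg : NN w ℓ g) (hf : IsAff f) :
    NN w ℓ (fun x => g (f x)) := by
  cases ℓ with
  | zero => exact IsAff.comp hg hf
  | succ ℓ =>
    obtain ⟨n, hn, A, hA, g', hg', hfg⟩ := hg
    exact ⟨n, hn, fun x => A (f x), hA.comp hf, g', hg', fun x => hfg _⟩

/-- The last affine map of `f` and the first one of `g` merge, so the depths add without an extra
layer. -/
theorem NN.comp {f : E → F} {g : F → G} (hg : NN w ℓ₂ g) (hf : NN w ℓ₁ f) :
    NN w (ℓ₁ + ℓ₂) (fun x => g (f x)) := by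
  induction ℓ₁ generalizing E with
  | zero => simpa using hg.comp_isAff hf
  | succ ℓ ih =>
    obtain ⟨n, hn, A, hA, f', hf', hff⟩ := hf
    rw [Nat.add_right_comm]
    exact ⟨n, hn, A, hA, fun x => g (f' x), ih hf', fun x => congrArg g (hff x)⟩

theorem NN.comp_max {f : E → F} {g : F → G} (hg : NN w₂ ℓ₂ g) (hf : NN w₁ ℓ₁ f) :
    NN (max w₁ w₂) (ℓ₁ + ℓ₂) (fun x => g (f x)) :=
  (hg.mono (le_max_right _ _)).comp (hf.mono (le_max_left _ _))

theorem NN.isAff_comp {f : E → F} {g : F → G} (hg : IsAff g) (hf : NN w ℓ f) :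
    NN w ℓ (fun x => g (f x)) :=
  NN.comp (ℓ₂ := 0) hg hf

/-- Layers are concatenated side by side. This requires equal depths, which is why `NN` fixes the
number of hidden layers exactly. -/
theorem NN.prodMk {f : E → F} {g : E → G} (hf : NN w₁ ℓ f) (hg : NN w₂ ℓ g) :
    NN (w₁ + w₂) ℓ (fun x => (f x, g x)) := by
  induction ℓ generalizing E with
  | zero => exact IsAff.prodMk hf hg
  | succ ℓ ih =>
    obtain ⟨n, hn, A, hA, f', hf', hff⟩ := hf
    obtain ⟨m, hm, B, hB, g', hg', hgg⟩ := hg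
    refine ⟨n + m, by omega, fun x => Fin.append (A x) (B x), ?_,
      fun y => (f' fun i => y (Fin.castAdd m i), g' fun i => y (Fin.natAdd n i)), ?_, ?_⟩
    · refine IsAff.pi fun i => ?_
      refine Fin.addCases (fun i => ?_) (fun i => ?_) i
      · simpa only [Fin.append_left] using (isAff_apply i).comp hA
      · simpa only [Fin.append_right] using (isAff_apply i).comp hB
    · exact ih (hf'.comp_isAff (by fun_prop)) (hg'.comp_isAff (by fun_prop))
    · intro x
      simp only [hff, hgg, ReLUApprox.relu, Fin.append_left, Fin.append_right]
      rfl

theorem NN.const (c : F) : NN w ℓ (fun _ : E => c) := by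
  induction ℓ generalizing E with
  | zero => exact isAff_const c
  | succ ℓ ih => exact ⟨0, by omega, fun _ _ => 0, isAff_const _, fun _ => c, ih, fun _ => rfl⟩

theorem NN.pi {n : ℕ} {f : Fin n → E → F} (hf : ∀ i, NN w ℓ (f i)) :
    NN (n * w) ℓ (fun x i => f i x) := by
  induction n with
  | zero => convert NN.const (w := 0 * w) (ℓ := ℓ) (E := E) (0 : Fin 0 → F) using 3
  | succ n ih =>
    have h := (ih (f := fun i => f i.succ) fun i => hf _).prodMk (hf 0)
    have h2 := h.isAff_comp (g := fun p : (Fin n → F) × F => (Fin.cons p.2 p.1 : Fin (n+1) → F)) (by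
      refine IsAff.pi fun i => ?_
      refine Fin.cases ?_ (fun i => ?_) i
      · simpa only [Fin.cons_zero] using isAff_id.snd
      · simpa only [Fin.cons_succ] using (isAff_apply i).comp isAff_id.fst)
    rw [Nat.succ_mul]
    convert h2 using 3 with x i
    refine Fin.cases ?_ (fun i => ?_) i <;> simp

theorem NN.sum {ι : Type} (S : Finset ι) {f : ι → E → F} (hf : ∀ i ∈ S, NN w ℓ (f i)) :
    NN (S.card * w) ℓ (fun x => ∑ i ∈ S, f i x) := by
  classical
  induction S using Finset.induction_on with
  | empty => simpa using NN.const (w := 0 * w) (E := E) (0 : F)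
  | insert a S ha ih =>
    simp only [Finset.sum_insert ha, Finset.card_insert_of_notMem ha, Nat.succ_mul]
    rw [add_comm]
    exact ((hf a (by simp)).prodMk (ih fun i hi => hf i (by simp [hi]))).isAff_comp
      (g := fun p : F × F => p.1 + p.2) (by fun_prop)

theorem NN.relu {f : E → ℝ} (hf : IsAff f) : NN 1 1 (fun x => max 0 (f x)) :=
  ⟨1, le_rfl, fun x _ => f x, by fun_prop, fun y => y 0,
    (isAff_apply 0 : IsAff fun y : Fin 1 → ℝ => y 0), fun _ => rfl⟩

theorem NN.iterate {f : ℕ → E → E} (hf : ∀ i, NN w ℓ (f i)) (n : ℕ) :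
    NN w (n * ℓ) (fun x => (List.range n).foldl (fun y i => f i y) x) := by
  induction n with
  | zero => simpa using NN.of_isAff (w := w) (isAff_id (E := E))
  | succ n ih =>
    simp only [List.range_succ, List.foldl_append, List.foldl_cons, List.foldl_nil, Nat.succ_mul]
    exact (hf n).comp ih

/-- Since `x = max 0 x - max 0 (-x)`, carrying a real number through any number of layers costs two
neurons per layer; this is the source of most summands 2 in the widths below. -/
theorem NN.id_real : NN 2 ℓ (fun x : ℝ => x) := by
  induction ℓ with
  | zero => exact isAff_id
  | succ ℓ ih =>
    have h := ((NN.relu (f := fun x : ℝ => x) (by fun_prop)).prodMk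
      (NN.relu (f := fun x : ℝ => -x) (by fun_prop))).isAff_comp
      (g := fun p : ℝ × ℝ => p.1 - p.2) (by fun_prop)
    have h2 := ih.comp h
    rw [add_comm] at h2
    convert h2 using 2 with x
    simp only [max_def]
    split_ifs <;> linarith

theorem NN.of_isAff_real {f : E → ℝ} (hf : IsAff f) : NN 2 ℓ f :=
  NN.id_real.comp_isAff hf

theorem NN.pad {f : E → ℝ} (hf : NN w ℓ₁ f) (hw : 2 ≤ w) (h : ℓ₁ ≤ ℓ₂) : NN w ℓ₂ f := by
  have := (NN.id_real (ℓ := ℓ₂ - ℓ₁)).mono hw |>.comp hf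
  rwa [Nat.add_sub_cancel' h] at this

theorem NN.congr {f g : E → F} (hf : NN w ℓ f) (h : ∀ x, f x = g x) : NN w ℓ g := by
  rwa [← funext h]

/-- A sum of networks computed one after the other, with the input carried along. -/
theorem NN.serial_sum {e : ℕ} {f : ℕ → E → ℝ} (hf : ∀ i, NN w ℓ (f i))
    (he : NN e ℓ (fun x : E => x)) (n : ℕ) :
    NN (w + e + 2) (n * ℓ) (fun x => ∑ i ∈ Finset.range n, f i x) := by
  -- The state is the input and a running total: `w` neurons for the new summand, `e` for the input,
  -- 2 for the total.
  let g : ℕ → E × ℝ → E × ℝ := fun i p => (p.1, p.2 + f i p.1)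
  have hg : ∀ i, NN (w + e + 2) ℓ (g i) := fun i =>
    ((((hf i).comp_isAff (f := fun p : E × ℝ => p.1) (by fun_prop)).prodMk
      (he.comp_isAff (f := fun p : E × ℝ => p.1) (by fun_prop))).prodMk
      (NN.of_isAff_real (f := fun p : E × ℝ => p.2) (by fun_prop))).isAff_comp
      (g := fun q : (ℝ × E) × ℝ => (q.1.2, q.2 + q.1.1)) (by fun_prop)
  have h := ((NN.iterate hg n).isAff_comp (g := fun p : E × ℝ => p.2) (by fun_prop)).comp_isAff
    (f := fun x : E => (x, (0 : ℝ))) (by fun_prop)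
  refine h.congr fun x => ?_
  have key : (List.range n).foldl (fun y i => g i y) (x, 0)
      = (x, ∑ i ∈ Finset.range n, f i x) := by
    clear h
    induction n with
    | zero => simp
    | succ n ih => simp [List.range_succ, ih, g, Finset.sum_range_succ]
  rw [key]

end Calculus

/-! ### Passage to explicit weight matrices -/

theorem IsAff.exists_matrix {m k : ℕ} {f : (Fin m → ℝ) → (Fin k → ℝ)} (hf : IsAff f) :
    ∃ (W : Matrix (Fin k) (Fin m) ℝ) (b : Fin k → ℝ), ∀ x, f x = W *ᵥ x + b := by
  obtain ⟨A, rfl⟩ := hf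
  refine ⟨LinearMap.toMatrix' A.linear, A 0, fun x => ?_⟩
  rw [LinearMap.toMatrix'_mulVec]
  simpa using congrFun A.decomp x

theorem NN.exists_net {m w ℓ : ℕ} {f : (Fin m → ℝ) → ℝ} (hf : NN w ℓ f) :
    ∃ (ws : List ℕ) (net : ReLUNet 1 m ws), (∀ n ∈ ws, n ≤ w) ∧ ws.length = ℓ ∧
      ∀ x, f x = net.eval x 0 := by
  induction ℓ generalizing m with
  | zero =>
    obtain ⟨W, b, h⟩ := IsAff.exists_matrix (f := fun x (_ : Fin 1) => f x)
      (IsAff.pi fun _ => hf)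
    exact ⟨[], .output W b, by simp, rfl, fun x => congrFun (h x) 0⟩
  | succ ℓ ih =>
    obtain ⟨n, hn, A, hA, g, hg, hfg⟩ := hf
    obtain ⟨ws, net, h1, h2, h3⟩ := ih hg
    obtain ⟨W, b, h⟩ := hA.exists_matrix
    refine ⟨n :: ws, .hidden W b net, by simpa using ⟨hn, h1⟩, by simp [h2], fun x => ?_⟩
    rw [hfg, h3, h]
    rfl

theorem NN.isImplementedBy {d w ℓ : ℕ} {f : (Fin d → ℝ) → ℝ} (hf : NN w ℓ f) {a b : ℝ}
    (ha : (w : ℝ) ≤ a) (hb : (ℓ : ℝ) ≤ b) : IsImplementedBy f a b := by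
  obtain ⟨ws, net, h1, h2, h3⟩ := hf.exists_net
  exact ⟨ws, net, fun n hn => (Nat.cast_le.2 (h1 n hn)).trans ha, by rwa [h2], h3⟩

/-! ### Steps, hats, medians and digits of a cell index -/

section Gadgets

variable {E F G : Type} [AddCommGroup E] [Module ℝ E] [AddCommGroup F] [Module ℝ F]
  [AddCommGroup G] [Module ℝ G] {w w₁ w₂ ℓ ℓ₁ ℓ₂ : ℕ}

/-- A continuous step: `0` for `u ≤ -η` and `1` for `u ≥ 0`. -/
noncomputable def step (η u : ℝ) : ℝ := (max 0 (u + η) - max 0 u) / η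

theorem step_of_nonneg {η u : ℝ} (hη : 0 < η) (hu : 0 ≤ u) : step η u = 1 := by
  rw [step, max_eq_right hu, max_eq_right (by linarith)]
  field_simp
  ring

theorem step_of_le {η u : ℝ} (hη : 0 < η) (hu : u ≤ -η) : step η u = 0 := by
  rw [step, max_eq_left (by linarith : u ≤ 0), max_eq_left (by linarith)]
  simp

theorem NN.step (η : ℝ) {f : E → ℝ} (hf : IsAff f) : NN 2 1 (fun x => step η (f x)) :=
  ((NN.relu (f := fun x => f x + η) (by fun_prop)).prodMk (NN.relu hf)).isAff_comp
    (g := fun p : ℝ × ℝ => (p.1 - p.2) / η) (by fun_prop)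

/-- The hat function, which is the indicator of `0` on the integers. -/
def hat (u : ℝ) : ℝ := max 0 (u + 1) - 2 * max 0 u + max 0 (u - 1)

theorem hat_intCast (n : ℤ) : hat n = if n = 0 then 1 else 0 := by
  unfold hat
  split_ifs with h
  · subst h; norm_num
  · rcases lt_or_gt_of_ne h with h | h
    · have h' : (n : ℝ) ≤ -1 := by exact_mod_cast (by omega : n ≤ -1)
      rw [max_eq_left (by linarith), max_eq_left (by linarith), max_eq_left (by linarith)]; ring
    · have h' : (1 : ℝ) ≤ n := by exact_mod_cast (by omega : 1 ≤ n)
      rw [max_eq_right (by linarith), max_eq_right (by linarith), max_eq_right (by linarith)]; ring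

theorem hat_natCast_sub (m n : ℕ) : hat ((m : ℝ) - n) = if m = n then 1 else 0 := by
  have := hat_intCast ((m : ℤ) - n)
  push_cast at this
  rw [this]
  simp only [sub_eq_zero, Nat.cast_inj]

theorem NN.hat {f : E → ℝ} (hf : IsAff f) : NN 3 1 (fun x => hat (f x)) :=
  (((NN.relu (f := fun x => f x + 1) (by fun_prop)).prodMk (NN.relu hf)).prodMk
    (NN.relu (f := fun x => f x - 1) (by fun_prop))).isAff_comp
    (g := fun p : (ℝ × ℝ) × ℝ => p.1.1 - 2 * p.1.2 + p.2) (by fun_prop)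

/-- Clamping to the unit interval. -/
def clamp (u : ℝ) : ℝ := max 0 u - max 0 (u - 1)

theorem clamp_eq (u : ℝ) : clamp u = max 0 (min 1 u) := by
  unfold clamp
  rcases le_total u 0 with h | h
  · rw [max_eq_left h, max_eq_left (by linarith), min_eq_right (by linarith), max_eq_left h]; ring
  · rcases le_total u 1 with h1 | h1
    · rw [max_eq_right h, max_eq_left (by linarith), min_eq_right h1, max_eq_right h]; ring
    · rw [max_eq_right h, max_eq_right (by linarith), min_eq_left h1, max_eq_right zero_le_one]; ring

theorem clamp_nonneg (u : ℝ) : 0 ≤ clamp u := by rw [clamp_eq]; exact le_max_left _ _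

theorem clamp_le_one (u : ℝ) : clamp u ≤ 1 := by
  rw [clamp_eq]; exact max_le zero_le_one (min_le_left _ _)

theorem clamp_of_mem {u : ℝ} (h0 : 0 ≤ u) (h1 : u ≤ 1) : clamp u = u := by
  rw [clamp_eq, min_eq_right h1, max_eq_right h0]

theorem abs_clamp_sub_le (u v : ℝ) : |clamp u - clamp v| ≤ |u - v| := by
  rw [clamp_eq, clamp_eq]
  calc _ ≤ |min 1 u - min 1 v| := by
        simpa using abs_max_sub_max_le_max 0 (min 1 u) 0 (min 1 v)
    _ ≤ |u - v| := by
        simpa using abs_min_sub_min_le_max 1 u 1 v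

theorem NN.clamp {f : E → ℝ} (hf : IsAff f) : NN 2 1 (fun x => clamp (f x)) :=
  ((NN.relu hf).prodMk (NN.relu (f := fun x => f x - 1) (by fun_prop))).isAff_comp
    (g := fun p : ℝ × ℝ => p.1 - p.2) (by fun_prop)

/-- The median of three numbers. -/
def mid (a b c : ℝ) : ℝ := a + b - c - max 0 (b + max 0 (a - b) - c) + max 0 (c - a + max 0 (a - b))

/-- The formula for `mid` is the sum of the three numbers minus their maximum and their minimum. A
median lies between any two of its arguments, so one wild value does no harm. -/
theorem mid_mem {a b c u v : ℝ}
    (h : (a ∈ Set.Icc u v ∧ b ∈ Set.Icc u v) ∨ (a ∈ Set.Icc u v ∧ c ∈ Set.Icc u v) ∨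
      (b ∈ Set.Icc u v ∧ c ∈ Set.Icc u v)) : mid a b c ∈ Set.Icc u v := by
  simp only [Set.mem_Icc] at *
  unfold mid
  rcases max_cases 0 (a - b) with ⟨h1, h1'⟩ | ⟨h1, h1'⟩ <;> rw [h1] <;>
  rcases max_cases 0 (c - a + (0 : ℝ)) with ⟨h2, h2'⟩ | ⟨h2, h2'⟩ <;>
  rcases max_cases 0 (c - a + (a - b)) with ⟨h3, h3'⟩ | ⟨h3, h3'⟩ <;>
  rcases max_cases 0 (b + 0 - c) with ⟨h4, h4'⟩ | ⟨h4, h4'⟩ <;>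
  rcases max_cases 0 (b + (a - b) - c) with ⟨h5, h5'⟩ | ⟨h5, h5'⟩ <;>
  simp only [h2, h3, h4, h5] <;>
  rcases h with ⟨⟨_, _⟩, _, _⟩ | ⟨⟨_, _⟩, _, _⟩ | ⟨⟨_, _⟩, _, _⟩ <;>
  constructor <;> linarith

theorem NN.mid : NN 7 2 (fun p : ℝ × ℝ × ℝ => mid p.1 p.2.1 p.2.2) := by
  have h1 : NN 7 1 (fun p : ℝ × ℝ × ℝ => (((max 0 (p.1 - p.2.1), p.1), p.2.1), p.2.2)) :=
    (((NN.relu (by fun_prop)).prodMk (NN.of_isAff_real (by fun_prop))).prodMk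
      (NN.of_isAff_real (by fun_prop))).prodMk (NN.of_isAff_real (by fun_prop))
  have h2 : NN 4 1 (fun q : ((ℝ × ℝ) × ℝ) × ℝ =>
      ((max 0 (q.1.2 + q.1.1.1 - q.2), max 0 (q.2 - q.1.1.2 + q.1.1.1)),
        q.1.1.2 + q.1.2 - q.2)) :=
    ((NN.relu (by fun_prop)).prodMk (NN.relu (by fun_prop))).prodMk
      (NN.of_isAff_real (by fun_prop))
  exact ((h2.mono (by norm_num)).comp h1).isAff_comp
    (g := fun q : (ℝ × ℝ) × ℝ => q.2 - q.1.1 + q.1.2) (by fun_prop)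

/-- `t ∈ [k/M, (k+1)/M - δ/M]`, where the last interval is closed up to the right. -/
def Cell (M : ℕ) (δ t : ℝ) (k : ℕ) : Prop :=
  k < M ∧ (k : ℝ) ≤ M * t ∧ (k + 1 < M → M * t ≤ k + 1 - δ)

/-- Blocks of `m` fine cells form a coarse cell, and a gap `δ` on the fine scale is `δ / m` on the
coarse one. In `Cell.mul_right` the scale is unchanged, so the gap stays `δ`. -/
theorem Cell.mul_left {a m k : ℕ} {δ t : ℝ} (hδ : 0 < δ) (h : Cell (a * m) δ t k) :
    Cell a (δ / m) t (k / m) := by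
  obtain ⟨h1, h2, h3⟩ := h
  have hm : 0 < m := Nat.pos_of_ne_zero (by rintro rfl; simp at h1)
  have hm' : (0 : ℝ) < m := by exact_mod_cast hm
  have hk := Nat.div_add_mod k m
  have hr := Nat.mod_lt k hm
  have hk' : (m : ℝ) * (k / m : ℕ) ≤ k := by exact_mod_cast Nat.mul_div_le k m
  push_cast at h2 h3
  refine ⟨Nat.div_lt_of_lt_mul (by rwa [mul_comm]), ?_, fun h => ?_⟩
  · refine le_of_mul_le_mul_left ?_ hm'
    linarith
  · have h4 : k + 1 ≤ m * (k / m + 1) := by rw [mul_add]; omega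
    have h5 : m * (k / m + 1) < a * m := by
      rw [mul_comm a]; exact Nat.mul_lt_mul_of_pos_left h hm
    have h6 := h3 (h4.trans_lt h5)
    have h7 : ((k : ℝ) + 1) ≤ m * ((k / m : ℕ) + 1) := by exact_mod_cast h4
    refine le_of_mul_le_mul_left ?_ hm'
    have : (m : ℝ) * (δ / m) = δ := by field_simp
    linarith

theorem Cell.mul_right {a m k : ℕ} {δ t : ℝ} (h : Cell (a * m) δ t k) :
    Cell m δ (a * t - (k / m : ℕ)) (k % m) := by
  obtain ⟨h1, h2, h3⟩ := h
  have hm : 0 < m := Nat.pos_of_ne_zero (by rintro rfl; simp at h1)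
  have hk : (m : ℝ) * (k / m : ℕ) + (k % m : ℕ) = k := by exact_mod_cast Nat.div_add_mod k m
  have hr := Nat.mod_lt k hm
  push_cast at h2 h3
  refine ⟨hr, by linarith, fun h => ?_⟩
  have h4 : k / m < a := Nat.div_lt_of_lt_mul (by rwa [mul_comm])
  have h5 : k + 1 < a * m := by
    have := Nat.div_add_mod k m
    have h6 : m * (k / m + 1) ≤ m * a := Nat.mul_le_mul_left m h4
    rw [mul_add] at h6
    rw [mul_comm a]
    omega
  have := h3 h5
  linarith

/-- Integers are fed to the digit networks through midpoints of cells, where the gap is `1 / 2` and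
the steps are exact. -/
theorem cell_integer {M k : ℕ} (hk : k < M) : Cell M (1 / 2) ((k + 1 / 2) / M) k := by
  have hM : (0 : ℝ) < M := by exact_mod_cast (Nat.zero_le k).trans_lt hk
  have : (M : ℝ) * ((k + 1 / 2) / M) = k + 1 / 2 := by field_simp
  refine ⟨hk, by rw [this]; linarith, fun _ => by rw [this]; linarith⟩

/-- The sum counts the thresholds `1, …, a - 1` passed by `a * t`. There is none at `a`, because the
last cell is closed on the right. -/
theorem sum_step {a k : ℕ} {η t : ℝ} (hη : 0 < η) (h : Cell a η t k) :
    ∑ j ∈ Finset.range (a - 1), step η (a * t - (j + 1)) = k := by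
  obtain ⟨h1, h2, h3⟩ := h
  have : ∀ j ∈ Finset.range (a - 1), step η (a * t - (j + 1)) = if j < k then 1 else 0 := by
    intro j hj
    rw [Finset.mem_range] at hj
    split_ifs with hjk
    · refine step_of_nonneg hη ?_
      have : (j : ℝ) + 1 ≤ k := by exact_mod_cast hjk
      linarith
    · refine step_of_le hη ?_
      have h4 := h3 (by omega)
      have : (k : ℝ) ≤ j := by exact_mod_cast not_lt.1 hjk
      linarith
  rw [Finset.sum_congr rfl this, ← Finset.sum_filter, Finset.sum_const, nsmul_eq_mul, mul_one]
  congr 1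
  rw [show (Finset.range (a - 1)).filter (· < k) = Finset.range k by
    ext j; simp only [Finset.mem_filter, Finset.mem_range]; omega]
  simp

/-- Networks of width `w` and depth `ℓ` compute the number of the cell of mesh size `1/M`. -/
def HasDigits (M w ℓ : ℕ) : Prop :=
  ∀ η : ℝ, 0 < η → ∃ φ : ℝ → ℝ, NN w ℓ φ ∧ ∀ t k, Cell M η t k → φ t = k

theorem hasDigits_wide (a : ℕ) : HasDigits a (2 * a) 1 := fun η hη =>
  ⟨_, ((NN.sum (Finset.range (a - 1)) fun j _ => NN.step η
    (f := fun t : ℝ => a * t - (j + 1)) (by fun_prop))).mono (by simp; omega),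
    fun t k h => sum_step hη h⟩

theorem hasDigits_deep (a : ℕ) : HasDigits a 6 a := fun η hη =>
  ⟨_, (NN.serial_sum (fun j => NN.step η (f := fun t : ℝ => a * t - (j + 1)) (by fun_prop))
    NN.id_real (a - 1)).pad (by norm_num) (by omega), fun t k h => sum_step hη h⟩

/-- Mixed radix: the leading digit is read first, subtracted, and the remainder is handed to the
second network. The coarse digit needs a finer tolerance, so `HasDigits` asks for every `η`. -/
theorem HasDigits.mul {M₁ M₂ : ℕ} (h₁ : HasDigits M₁ w₁ ℓ₁) (h₂ : HasDigits M₂ w₂ ℓ₂) :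
    HasDigits (M₁ * M₂) (max w₁ w₂ + 2) (ℓ₁ + ℓ₂) := by
  intro η hη
  rcases Nat.eq_zero_or_pos M₂ with rfl | hM
  · exact ⟨fun _ => 0, NN.const 0, fun t k h => by simp [Cell] at h⟩
  obtain ⟨φ₁, hφ₁, H₁⟩ := h₁ (η / M₂) (by positivity)
  obtain ⟨φ₂, hφ₂, H₂⟩ := h₂ η hη
  have A : NN (w₁ + 2) ℓ₁ (fun t => (φ₁ t, M₁ * t - φ₁ t)) :=
    (hφ₁.prodMk NN.id_real).isAff_comp (g := fun p : ℝ × ℝ => (p.1, M₁ * p.2 - p.1)) (by fun_prop)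
  have B : NN (w₂ + 2) ℓ₂ (fun p : ℝ × ℝ => M₂ * p.1 + φ₂ p.2) :=
    ((hφ₂.comp_isAff (f := fun p : ℝ × ℝ => p.2) (by fun_prop)).prodMk
      (NN.of_isAff_real (f := fun p : ℝ × ℝ => p.1) (by fun_prop))).isAff_comp
      (g := fun p : ℝ × ℝ => M₂ * p.2 + p.1) (by fun_prop)
  refine ⟨_, (B.comp_max A).mono (by omega), fun t k h => ?_⟩
  simp only [H₁ t _ (h.mul_left hη), H₂ _ _ h.mul_right]
  exact_mod_cast Nat.div_add_mod k M₂

end Gadgets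

/-! ### Bit extraction and storage of coefficients -/

section BitMemory

theorem NN.iterate_const {E : Type} [AddCommGroup E] [Module ℝ E] {w ℓ : ℕ} {f : E → E}
    (hf : NN w ℓ f) (n : ℕ) : NN w (n * ℓ) (f^[n]) := by
  induction n with
  | zero => rw [Nat.zero_mul]; exact NN.of_isAff isAff_id
  | succ n ih =>
    rw [Nat.succ_mul, Function.iterate_succ']
    exact hf.comp ih

theorem NN.id_prod {E F : Type} [AddCommGroup E] [Module ℝ E] [AddCommGroup F] [Module ℝ F]
    {a b ℓ : ℕ} (h₁ : NN a ℓ (fun x : E => x)) (h₂ : NN b ℓ (fun x : F => x)) :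
    NN (a + b) ℓ (fun x : E × F => x) :=
  (h₁.comp_isAff (f := fun x : E × F => x.1) (by fun_prop)).prodMk
    (h₂.comp_isAff (f := fun x : E × F => x.2) (by fun_prop))

/-- Networks of width `O(N)` and depth `O(L)` realize tables with `N * N * L` entries. -/
theorem exists_lookup (N L : ℕ) (v : ℕ → ℕ → ℕ → ℝ) (hv0 : ∀ a b c, 0 ≤ v a b c)
    (hv1 : ∀ a b c, v a b c ≤ 1) :
    ∃ φ : ℝ × ℝ × ℝ → ℝ, NN (6 * N + 11) (L * 2) φ ∧
      ∀ a b c : ℕ, a < N → b < N → c < L → φ (a, b, c) = v a b c := by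
  -- Block `c` looks up column `c` of the table. The inner sum selects row `a`; as entries are at
  -- most 1, subtracting 2 silences a neuron unless both `b = k` and the third index match.
  let f : ℕ → ℝ × ℝ × ℝ → ℝ := fun c p => ∑ k : Fin N,
    max 0 ((∑ j : Fin N, v j k c * hat (p.1 - (j : ℕ))) + hat (p.2.1 - (k : ℕ)) + hat (p.2.2 - c) - 2)
  have hf : ∀ c, NN (6 * N + 3) 2 (f c) := by
    intro c
    have h1 : NN (N * 3 + (N * 3 + 3)) 1 (fun p : ℝ × ℝ × ℝ =>
        ((fun j : Fin N => hat (p.1 - (j : ℕ))), (fun j : Fin N => hat (p.2.1 - (j : ℕ))),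
          hat (p.2.2 - c))) :=
      (NN.pi fun j => NN.hat (by fun_prop)).prodMk
        ((NN.pi fun j => NN.hat (by fun_prop)).prodMk (NN.hat (by fun_prop)))
    have h2 : NN (Finset.univ.card * 1) 1 (fun q : (Fin N → ℝ) × (Fin N → ℝ) × ℝ =>
        ∑ k : Fin N, max 0 ((∑ j : Fin N, v j k c * q.1 j) + q.2.1 k + q.2.2 - 2)) :=
      NN.sum Finset.univ fun k _ => NN.relu (by fun_prop)
    have h2' : NN (6 * N + 3) 1 _ := h2.mono (by rw [Finset.card_univ, Fintype.card_fin]; omega)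
    have h1' : NN (6 * N + 3) 1 _ := h1.mono (by omega)
    exact (h2'.comp h1').congr fun p => rfl
  refine ⟨_, NN.serial_sum hf (NN.id_prod NN.id_real (NN.id_prod NN.id_real NN.id_real)) L, ?_⟩
  intro a b c ha hb hc
  have key : ∀ c' (k : Fin N), max 0 ((∑ j : Fin N, v j k c' * hat ((a : ℝ) - (j : ℕ))) +
      hat ((b : ℝ) - (k : ℕ)) + hat ((c : ℝ) - c') - 2)
      = if k = ⟨b, hb⟩ then (if c' = c then v a b c else 0) else 0 := by
    intro c' k
    simp only [hat_natCast_sub]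
    rw [Finset.sum_eq_single ⟨a, ha⟩ (fun j _ hj => by
      rw [if_neg (fun h => hj (Fin.ext h.symm)), mul_zero]) (by simp)]
    have e1 : (b = (k : ℕ)) ↔ k = ⟨b, hb⟩ :=
      ⟨fun h => Fin.ext h.symm, fun h => by rw [h]⟩
    have hle := hv1 a k c'
    simp only [if_true, mul_one, e1, eq_comm (a := c)]
    split_ifs with h1 h2
    · subst h1 h2
      rw [max_eq_right] <;> linarith [hv0 a b c']
    all_goals rw [max_eq_left]; linarith
  simp only [f, key]
  simp [hc]

/-- The number with binary digits `θ 0, …, θ (L - 1)`. -/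
noncomputable def word (L : ℕ) (θ : ℕ → ℝ) : ℝ := ∑ c ∈ Finset.range L, θ c / 2 ^ (c + 1)

theorem word_succ (L : ℕ) (θ : ℕ → ℝ) :
    word (L + 1) θ = (θ 0 + word L fun c => θ (c + 1)) / 2 := by
  simp only [word, Finset.sum_range_succ', add_div, Finset.sum_div]
  rw [add_comm]
  congr 1
  · norm_num
  · refine Finset.sum_congr rfl fun c _ => ?_
    rw [div_div]
    congr 1

/-- The distance `(1 / 2) ^ L` from 1 is the room in which a continuous step can decide the leading
digit of a longer word without error. -/
theorem word_mem {L : ℕ} {θ : ℕ → ℝ} (hθ : ∀ c, θ c = 0 ∨ θ c = 1) :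
    0 ≤ word L θ ∧ word L θ ≤ 1 - (1 / 2) ^ L := by
  induction L generalizing θ with
  | zero => simp [word]
  | succ L ih =>
    have := ih (θ := fun c => θ (c + 1)) fun c => hθ _
    rw [word_succ, pow_succ]
    rcases hθ 0 with h | h <;> rw [h] <;> constructor <;> linarith [this.1, this.2]

/-- One step of reading the binary digits of a word. -/
noncomputable def readStep (η : ℝ) (p : ℝ × ℝ × ℝ) : ℝ × ℝ × ℝ :=
  (2 * p.1 - step η (p.1 - 1 / 2), p.2.1 - 1,
    p.2.2 + max 0 (step η (p.1 - 1 / 2) + hat p.2.1 - 1))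

theorem NN.readStep (η : ℝ) : NN 11 2 (ReLUApprox.readStep η) := by
  have h1 : NN (2 + (3 + (2 + (2 + 2)))) 1 (fun p : ℝ × ℝ × ℝ =>
      (ReLUApprox.step η (p.1 - 1 / 2), ReLUApprox.hat p.2.1, p.1, p.2.1, p.2.2)) :=
    (NN.step η (by fun_prop)).prodMk ((NN.hat (by fun_prop)).prodMk
      ((NN.of_isAff_real (by fun_prop)).prodMk
      ((NN.of_isAff_real (by fun_prop)).prodMk (NN.of_isAff_real (by fun_prop)))))
  have h2 : NN (2 + (2 + (2 + 1))) 1 (fun q : ℝ × ℝ × ℝ × ℝ × ℝ =>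
      (2 * q.2.2.1 - q.1, q.2.2.2.1 - 1, q.2.2.2.2, max 0 (q.1 + q.2.1 - 1))) :=
    (NN.of_isAff_real (by fun_prop)).prodMk ((NN.of_isAff_real (by fun_prop)).prodMk
      ((NN.of_isAff_real (by fun_prop)).prodMk (NN.relu (by fun_prop))))
  exact ((h2.mono (by norm_num)).comp h1).isAff_comp
    (g := fun q : ℝ × ℝ × ℝ × ℝ => (q.1, q.2.1, q.2.2.1 + q.2.2.2)) (by fun_prop)

/-- Each step shifts out the leading digit and lowers the counter; the digit is added only while the
counter is 0. The counter is an integer because it turns negative after the hit. -/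
theorem readStep_iterate {η : ℝ} (hη : 0 < η) (L : ℕ) (hL : η ≤ (1 / 2) ^ L) (θ : ℕ → ℝ)
    (hθ : ∀ c, θ c = 0 ∨ θ c = 1) (q : ℤ) (a : ℝ) :
    ((readStep η)^[L] (word L θ, q, a)).2.2
      = a + if 0 ≤ q ∧ q < L then θ q.toNat else 0 := by
  induction L generalizing θ q a with
  | zero => simp
  | succ L ih =>
    have hw := word_mem (L := L) (θ := fun c => θ (c + 1)) fun c => hθ _
    rw [pow_succ] at hL
    have hpos : (0 : ℝ) < (1 / 2) ^ L := by positivity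
    have hstep : step η (word (L + 1) θ - 1 / 2) = θ 0 := by
      rw [word_succ]
      rcases hθ 0 with h | h <;> rw [h]
      · exact step_of_le hη (by linarith)
      · exact step_of_nonneg hη (by linarith)
    rw [Function.iterate_succ_apply, readStep]
    simp only [hstep]
    rw [show 2 * word (L + 1) θ - θ 0 = word L fun c => θ (c + 1) by rw [word_succ]; ring,
      show (q : ℝ) - 1 = ((q - 1 : ℤ) : ℝ) by push_cast; ring,
      ih (by linarith) _ (fun c => hθ _), hat_intCast, add_assoc]
    congr 1
    rcases lt_trichotomy q 0 with h | h | h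
    · rw [if_neg (by omega), if_neg (by omega), if_neg (by omega)]
      rcases hθ 0 with h | h <;> rw [h] <;> norm_num
    · subst h
      simp only [if_true, Int.toNat_zero]
      rw [if_neg (by omega), if_pos (by omega)]
      rcases hθ 0 with h | h <;> rw [h] <;> norm_num
    · rw [if_neg (by omega)]
      have h0 : max 0 (θ 0 + 0 - 1) = 0 := by
        rcases hθ 0 with h | h <;> rw [h] <;> norm_num
      rw [h0, zero_add]
      have h1 : (q - 1).toNat + 1 = q.toNat := by omega
      rw [h1]
      congr 1
      push_cast
      exact propext ⟨fun _ => ⟨by omega, by omega⟩, fun _ => ⟨by omega, by omega⟩⟩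

theorem exists_readBit (L : ℕ) :
    ∃ φ : ℝ × ℝ → ℝ, NN 11 (L * 2) φ ∧ ∀ θ : ℕ → ℝ, (∀ c, θ c = 0 ∨ θ c = 1) →
      ∀ q : ℕ, q < L → φ (word L θ, q) = θ q := by
  refine ⟨_, (((NN.readStep ((1 / 2) ^ L)).iterate_const L).isAff_comp
    (g := fun p => p.2.2) (by fun_prop)).comp_isAff
    (f := fun p : ℝ × ℝ => (p.1, p.2, (0 : ℝ))) (by fun_prop), fun θ hθ q hq => ?_⟩
  have := readStep_iterate (η := (1 / 2) ^ L) (by positivity) L le_rfl θ hθ q 0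
  push_cast at this
  rw [this]
  simp [hq]

/-- Networks of width `O(N)` and depth `O(L)` store `(N * L)^2` bits. -/
theorem exists_bit_memory {N L : ℕ} (hN : 1 ≤ N) (hL : 1 ≤ L) (θ : ℕ → ℝ)
    (hθ : ∀ i, θ i = 0 ∨ θ i = 1) :
    ∃ φ : ℝ → ℝ, NN (6 * N + 13) (6 * L + 2) φ ∧
      ∀ i : ℕ, i < N * (N * (L * L)) → φ i = θ i := by
  -- The tolerances are the midpoint gap `1 / 2` divided by the number of finer cells, as in
  -- `Cell.mul_left`.
  obtain ⟨d₁, nd₁, hd₁⟩ := hasDigits_wide N (1 / 2 / (N * (L * L) : ℕ)) (by positivity)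
  obtain ⟨d₂, nd₂, hd₂⟩ := hasDigits_wide N (1 / 2 / (L * L : ℕ)) (by positivity)
  obtain ⟨d₃, nd₃, hd₃⟩ := hasDigits_deep L (1 / 2 / L) (by positivity)
  obtain ⟨d₄, nd₄, hd₄⟩ := hasDigits_deep L (1 / 2) (by positivity)
  -- An index has digits `a, b, c, q` in the radices `N, N, L, L`: the first three address a word,
  -- the last a position in it.
  let v : ℕ → ℕ → ℕ → ℝ := fun a b c =>
    word L fun q => θ (N * (L * L) * a + (L * L * b + (L * c + q)))
  have hv : ∀ a b c, 0 ≤ v a b c ∧ v a b c ≤ 1 := fun a b c => by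
    have h := word_mem (L := L) (θ := fun q => θ (N * (L * L) * a + (L * L * b + (L * c + q))))
      fun c => hθ _
    have : (0 : ℝ) < (1 / 2) ^ L := by positivity
    exact ⟨h.1, by linarith [h.2]⟩
  obtain ⟨V, nV, hV⟩ := exists_lookup N L v (fun a b c => (hv a b c).1) (fun a b c => (hv a b c).2)
  obtain ⟨R, nR, hR⟩ := exists_readBit L
  have A₁ : NN (2 * N + 2) 1 (fun t => (d₁ t, N * t - d₁ t)) :=
    (nd₁.prodMk NN.id_real).isAff_comp (g := fun p : ℝ × ℝ => (p.1, N * p.2 - p.1)) (by fun_prop)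
  have A₂ : NN (2 * N + (2 + 2)) 1 (fun p : ℝ × ℝ => (p.1, d₂ p.2, N * p.2 - d₂ p.2)) :=
    ((nd₂.comp_isAff (f := fun p : ℝ × ℝ => p.2) (by fun_prop)).prodMk
      (NN.id_prod NN.id_real NN.id_real)).isAff_comp
      (g := fun p : ℝ × ℝ × ℝ => (p.2.1, p.1, N * p.2.2 - p.1)) (by fun_prop)
  have A₃ : NN (6 + (2 + (2 + 2))) L
      (fun p : ℝ × ℝ × ℝ => ((p.1, p.2.1, d₃ p.2.2), L * p.2.2 - d₃ p.2.2)) :=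
    ((nd₃.comp_isAff (f := fun p : ℝ × ℝ × ℝ => p.2.2) (by fun_prop)).prodMk
      (NN.id_prod NN.id_real (NN.id_prod NN.id_real NN.id_real))).isAff_comp
      (g := fun p : ℝ × ℝ × ℝ × ℝ => ((p.2.1, p.2.2.1, p.1), L * p.2.2.2 - p.1)) (by fun_prop)
  have A₄ : NN ((2 + (2 + 2)) + 6) L (fun p : (ℝ × ℝ × ℝ) × ℝ => (p.1, d₄ p.2)) :=
    ((NN.id_prod NN.id_real (NN.id_prod NN.id_real NN.id_real)).comp_isAff
      (f := fun p : (ℝ × ℝ × ℝ) × ℝ => p.1) (by fun_prop)).prodMk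
      (nd₄.comp_isAff (f := fun p : (ℝ × ℝ × ℝ) × ℝ => p.2) (by fun_prop))
  have A₅ : NN ((6 * N + 11) + 2) (L * 2) (fun p : (ℝ × ℝ × ℝ) × ℝ => (V p.1, p.2)) :=
    (nV.comp_isAff (f := fun p : (ℝ × ℝ × ℝ) × ℝ => p.1) (by fun_prop)).prodMk
      (NN.of_isAff_real (by fun_prop))
  have B := (((((nR.mono (by omega)).comp (A₅.mono (w₂ := 6 * N + 13) (by omega))).comp
    (A₄.mono (by omega))).comp (A₃.mono (by omega))).comp (A₂.mono (by omega))).comp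
    (A₁.mono (by omega))
  have B' := B.comp_isAff (f := fun i : ℝ => (i + 1 / 2) / (N * (N * (L * L)) : ℕ)) (by fun_prop)
  rw [show 1 + (1 + (L + (L + (L * 2 + L * 2)))) = 6 * L + 2 by ring] at B'
  refine ⟨_, B', fun i hi => ?_⟩
  have c₀ := cell_integer hi
  have c₁ := c₀.mul_right
  have c₂ := c₁.mul_right
  have c₃ := c₂.mul_right
  simp only [hd₁ _ _ (c₀.mul_left (by norm_num)), hd₂ _ _ (c₁.mul_left (by norm_num)),
    hd₃ _ _ (c₂.mul_left (by norm_num)), hd₄ _ _ c₃]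
  have hLL : 0 < L * L := by positivity
  rw [hV _ _ _ (c₀.mul_left (by norm_num)).1 (c₁.mul_left (by norm_num)).1
    (c₂.mul_left (by norm_num)).1, hR _ (fun c => hθ _) _ c₃.1, Nat.div_add_mod, Nat.div_add_mod,
    Nat.div_add_mod]

theorem exists_binary_digits (J : ℕ) {ξ : ℝ} (h0 : 0 ≤ ξ) (h1 : ξ ≤ 1) :
    ∃ b : ℕ → ℝ, (∀ j, b j = 0 ∨ b j = 1) ∧ |ξ - word J b| ≤ (1 / 2) ^ J := by
  induction J generalizing ξ with
  | zero => exact ⟨fun _ => 0, fun _ => Or.inl rfl, by simp [word, abs_of_nonneg h0, h1]⟩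
  | succ J ih =>
    have key : ∀ β : ℝ, (β = 0 ∨ β = 1) → 0 ≤ 2 * ξ - β → 2 * ξ - β ≤ 1 →
        ∃ b : ℕ → ℝ, (∀ j, b j = 0 ∨ b j = 1) ∧ |ξ - word (J + 1) b| ≤ (1 / 2) ^ (J + 1) := by
      intro β hβ h2 h3
      obtain ⟨b, hb, h⟩ := ih h2 h3
      refine ⟨fun j => if j = 0 then β else b (j - 1), fun j => ?_, ?_⟩
      · dsimp only; split_ifs
        exacts [hβ, hb _]
      · rw [word_succ]
        simp only [if_true, Nat.add_one_ne_zero, if_false, Nat.add_sub_cancel]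
        rw [show ξ - (β + word J fun c => b c) / 2 = (2 * ξ - β - word J b) / 2 by ring, abs_div,
          abs_two, pow_succ]
        linarith
    rcases le_total ξ (1 / 2) with h | h
    · exact key 0 (Or.inl rfl) (by linarith) (by linarith)
    · exact key 1 (Or.inr rfl) (by linarith) (by linarith)

theorem sum_range_mul {M : Type} [AddCommMonoid M] (F : ℕ → M) (Q P : ℕ) :
    ∑ j ∈ Finset.range (Q * P), F j
      = ∑ c ∈ Finset.range Q, ∑ j ∈ Finset.range P, F (c * P + j) := by
  induction Q with
  | zero => simp
  | succ Q ih => rw [Nat.succ_mul, Finset.sum_range_add, ih, Finset.sum_range_succ]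

/-- Multiplication with `(N * L)^2` stored coefficients in `[0,1]`, up to an error of `2^(-P * Q)`. -/
theorem exists_coefficient_mul {N L : ℕ} (hN : 1 ≤ N) (hL : 1 ≤ L) (P Q : ℕ) (ξ : ℕ → ℝ)
    (h0 : ∀ i, 0 ≤ ξ i) (h1 : ∀ i, ξ i ≤ 1) :
    ∃ φ : ℝ × ℝ → ℝ, NN (P * (6 * N + 15) + 6) (Q * (6 * L + 3)) φ ∧
      ∀ (i : ℕ) (g : ℝ), i < N * (N * (L * L)) → 0 ≤ g → g ≤ 1 →
        |φ (i, g) - ξ i * g| ≤ (1 / 2) ^ (Q * P) := by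
  choose b hb hξ using fun i => exists_binary_digits (Q * P) (h0 i) (h1 i)
  choose β nβ hβ using fun j => exists_bit_memory hN hL (fun i => b i j) fun i => hb i j
  -- For a bit `b` and `0 ≤ g ≤ 1` one has `b * g = max 0 (b + g - 1)`, so one neuron multiplies
  -- exactly.
  have hF : ∀ j, NN (6 * N + 15) (6 * L + 3)
      (fun p : ℝ × ℝ => 1 / 2 ^ (j + 1) * max 0 (β j p.1 + p.2 - 1)) := by
    intro j
    have h1 : NN (6 * N + 13 + 2) (6 * L + 2) (fun p : ℝ × ℝ => (β j p.1, p.2)) :=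
      ((nβ j).comp_isAff (f := fun p : ℝ × ℝ => p.1) (by fun_prop)).prodMk
        (NN.of_isAff_real (by fun_prop))
    have h2 : NN (6 * N + 15) 1 (fun q : ℝ × ℝ => max 0 (q.1 + q.2 - 1)) :=
      (NN.relu (by fun_prop)).mono (by omega)
    exact (h2.comp h1).isAff_comp (g := fun r : ℝ => 1 / 2 ^ (j + 1) * r) (by fun_prop)
  -- Of the `Q * P` bit planes, `P` run in parallel and `Q` such groups in series.
  have hS := NN.serial_sum (e := 4) (fun c => (NN.sum (Finset.range P) fun j _ => hF (c * P + j)))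
    (NN.id_prod NN.id_real NN.id_real) Q
  have hS' := (hS.mono (w₂ := P * (6 * N + 15) + 6) (by simp)).congr fun p =>
    (sum_range_mul (fun j => 1 / 2 ^ (j + 1) * max 0 (β j p.1 + p.2 - 1)) Q P).symm
  refine ⟨_, hS', fun i g hi hg0 hg1 => ?_⟩
  have : ∑ j ∈ Finset.range (Q * P), 1 / 2 ^ (j + 1) * max 0 (β j i + g - 1)
      = word (Q * P) (b i) * g := by
    rw [word, Finset.sum_mul]
    refine Finset.sum_congr rfl fun j _ => ?_
    rw [hβ j i hi]
    rcases hb i j with h | h <;> rw [h]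
    · rw [max_eq_left (by linarith)]; ring
    · rw [max_eq_right (by linarith)]; ring
  simp only [this]
  rw [← sub_mul, abs_mul, abs_of_nonneg hg0, abs_sub_comm]
  calc _ ≤ (1 / 2) ^ (Q * P) * 1 := mul_le_mul (hξ i) hg1 hg0 (by positivity)
    _ = _ := mul_one _

end BitMemory

/-! ### Squares, products and monomials -/

section Monomials

/-- The zigzag function: `saw M u` is the distance of `u ∈ [0, M]` to the even integers. -/
def saw (M : ℕ) (u : ℝ) : ℝ :=
  ∑ j ∈ Finset.range M, (if j = 0 then 1 else 2 * (-1) ^ j) * max 0 (u - j)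

/-- The piecewise linear interpolation of `u ^ 2` at the integers of `[0, M]`. -/
def chord (M : ℕ) (u : ℝ) : ℝ :=
  ∑ j ∈ Finset.range M, (if j = 0 then 1 else 2) * max 0 (u - j)

theorem sum_range_relu_eq {M k : ℕ} (hk : k < M) {u : ℝ} (h0 : (k : ℝ) ≤ u) (h1 : u ≤ k + 1)
    (c : ℕ → ℝ) :
    ∑ j ∈ Finset.range M, c j * max 0 (u - j) = ∑ j ∈ Finset.range (k + 1), c j * (u - j) := by
  rw [← Finset.sum_subset (Finset.range_mono (show k + 1 ≤ M from hk))]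
  · refine Finset.sum_congr rfl fun j hj => ?_
    have : (j : ℝ) ≤ k := by exact_mod_cast Nat.lt_succ_iff.1 (Finset.mem_range.1 hj)
    rw [max_eq_right (by linarith)]
  · intro j _ hj
    have : (k : ℝ) + 1 ≤ j := by
      exact_mod_cast not_lt.1 (fun h => hj (Finset.mem_range.2 h))
    rw [max_eq_left (by linarith), mul_zero]

theorem saw_eq {M k : ℕ} (hk : k < M) {u : ℝ} (h0 : (k : ℝ) ≤ u) (h1 : u ≤ k + 1) :
    saw M u = if Even k then u - k else k + 1 - u := by
  rw [saw, sum_range_relu_eq hk h0 h1]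
  clear h0 h1 hk
  induction k with
  | zero => simp
  | succ k ih =>
    rw [Finset.sum_range_succ, ih]
    push_cast
    by_cases h : Even k
    · rw [if_pos h, if_neg (by simpa [Nat.even_add_one] using h), pow_succ, h.neg_one_pow]
      ring
    · rw [if_neg h, if_pos (by simpa [Nat.even_add_one] using h), pow_succ, (Nat.not_even_iff_odd.1 h).neg_one_pow]
      ring

theorem chord_eq {M k : ℕ} (hk : k < M) {u : ℝ} (h0 : (k : ℝ) ≤ u) (h1 : u ≤ k + 1) :
    chord M u = (2 * k + 1) * u - k * (k + 1) := by
  rw [chord, sum_range_relu_eq hk h0 h1]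
  clear h0 h1 hk
  induction k with
  | zero => simp
  | succ k ih =>
    rw [Finset.sum_range_succ, ih, if_neg (by omega)]
    push_cast
    ring

/-- With `v = u - k` on `[k, k + 1]`, the chord exceeds the square by `v * (1 - v)`, and `saw` is
`v` or `1 - v`. The error thus has the form `p * (1 - p)` again, which makes the iteration
self-similar. -/
theorem saw_spec {M : ℕ} {u : ℝ} (h0 : 0 ≤ u) (h1 : u ≤ M) :
    0 ≤ saw M u ∧ saw M u ≤ 1 ∧ chord M u - u ^ 2 = saw M u * (1 - saw M u) := by
  rcases Nat.eq_zero_or_pos M with rfl | hM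
  · have : u = 0 := le_antisymm (by simpa using h1) h0
    simp [saw, chord, this]
  obtain ⟨k, hk, hk0, hk1⟩ : ∃ k : ℕ, k < M ∧ (k : ℝ) ≤ u ∧ u ≤ k + 1 := by
    rcases h1.eq_or_lt with h | h
    · refine ⟨M - 1, by omega, ?_, ?_⟩ <;> rw [Nat.cast_sub hM, h] <;> push_cast <;> linarith
    · exact ⟨⌊u⌋₊, (Nat.floor_lt h0).2 h, Nat.floor_le h0, (Nat.lt_floor_add_one u).le⟩
  rw [saw_eq hk hk0 hk1, chord_eq hk hk0 hk1]
  split_ifs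
  · exact ⟨by linarith, by linarith, by ring⟩
  · exact ⟨by linarith, by linarith, by ring⟩

/-- Networks of width `O(M)` and depth `m` approximate the square up to `M^(-2m)`. -/
theorem exists_square {M : ℕ} (hM : 1 ≤ M) (m : ℕ) :
    ∃ φ : ℝ → ℝ, NN (2 * M + 4) m φ ∧
      ∀ x, 0 ≤ x → x ≤ 1 → |φ x - x ^ 2| ≤ 1 / 4 * (1 / (M : ℝ) ^ 2) ^ m := by
  -- For `u = M * p` and `z = saw M u`, `p * (1 - p) = (p - chord M u / M ^ 2) + z * (1 - z) / M ^
  -- 2`. Each layer collects the bracket and gains a factor `M ^ (-2)` in the rest.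
  let f : ℕ → ℝ × ℝ → ℝ × ℝ := fun k p =>
    (saw M (M * p.1), p.2 + (1 / (M : ℝ) ^ 2) ^ k * (p.1 - chord M (M * p.1) / M ^ 2))
  have hrelu : ∀ c : ℕ → ℝ, NN M 1 (fun p : ℝ × ℝ =>
      ∑ j ∈ Finset.range M, c j * max 0 ((M : ℝ) * p.1 - j)) := fun c =>
    (NN.sum (Finset.range M) fun j _ => (NN.relu (f := fun p : ℝ × ℝ => M * p.1 - j)
      (by fun_prop)).isAff_comp (g := fun r : ℝ => c j * r) (by fun_prop)).mono (by simp)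
  have hf : ∀ k, NN (2 * M + 4) 1 (f k) := by
    intro k
    have h : NN (M + (M + (2 + 2))) 1 (fun p : ℝ × ℝ =>
        (saw M (M * p.1), chord M (M * p.1), p.1, p.2)) :=
      (hrelu _).prodMk ((hrelu _).prodMk (NN.id_prod NN.id_real NN.id_real))
    have h' := h.isAff_comp (g := fun q : ℝ × ℝ × ℝ × ℝ =>
      (q.1, q.2.2.2 + (1 / (M : ℝ) ^ 2) ^ k * (q.2.2.1 - q.2.1 / M ^ 2))) (by fun_prop)
    exact h'.mono (by omega)
  have hN := ((NN.iterate hf m).isAff_comp (g := fun p : ℝ × ℝ => -p.2) (by fun_prop)).comp_isAff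
    (f := fun x : ℝ => (x, -x)) (by fun_prop)
  rw [mul_one] at hN
  refine ⟨_, hN, fun x h0 h1 => ?_⟩
  have hM' : (0 : ℝ) < M := by exact_mod_cast hM
  have key : ∀ n, let p := (List.range n).foldl (fun y i => f i y) (x, -x)
      0 ≤ p.1 ∧ p.1 ≤ 1 ∧ p.2 + (1 / (M : ℝ) ^ 2) ^ n * (p.1 * (1 - p.1)) = - x ^ 2 := by
    intro n
    induction n with
    | zero => simp only [List.range_zero, List.foldl_nil]; exact ⟨h0, h1, by ring⟩
    | succ n ih =>
      simp only [List.range_succ, List.foldl_append, List.foldl_cons, List.foldl_nil]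
      generalize (List.range n).foldl (fun y i => f i y) (x, -x) = p at *
      obtain ⟨i1, i2, i3⟩ := ih
      obtain ⟨s1, s2, s3⟩ := saw_spec (M := M) (u := M * p.1) (by positivity)
        (mul_le_of_le_one_right hM'.le i2)
      refine ⟨s1, s2, ?_⟩
      rw [← i3, ← s3]
      simp only [f]
      have he : (M : ℝ) ^ 2 * (1 / (M : ℝ) ^ 2) = 1 := by field_simp
      rw [div_eq_mul_one_div (chord M _)]
      linear_combination (-((1 / (M : ℝ) ^ 2) ^ n * p.1 ^ 2)) * he
  obtain ⟨k1, k2, k3⟩ := key m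
  generalize (List.range m).foldl (fun y i => f i y) (x, -x) = p at *
  have hp : 0 ≤ p.1 * (1 - p.1) := mul_nonneg k1 (by linarith)
  have hp' : p.1 * (1 - p.1) ≤ 1 / 4 := by nlinarith [sq_nonneg (p.1 - 1 / 2)]
  have hpos : (0 : ℝ) ≤ (1 / (M : ℝ) ^ 2) ^ m := by positivity
  rw [show -p.2 - x ^ 2 = (1 / (M : ℝ) ^ 2) ^ m * (p.1 * (1 - p.1)) by linarith,
    abs_of_nonneg (mul_nonneg hpos hp), mul_comm]
  exact mul_le_mul_of_nonneg_right hp' hpos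

theorem exists_mul {M : ℕ} (hM : 1 ≤ M) (m : ℕ) :
    ∃ φ : ℝ × ℝ → ℝ, NN (6 * M + 12) (m + 1) φ ∧ (∀ p, 0 ≤ φ p ∧ φ p ≤ 1) ∧
      ∀ x y, 0 ≤ x → x ≤ 1 → 0 ≤ y → y ≤ 1 →
        |φ (x, y) - x * y| ≤ (1 / (M : ℝ) ^ 2) ^ m := by
  obtain ⟨q, nq, hq⟩ := exists_square hM m
  -- Polarization: `x * y = 2 * ((x + y) / 2) ^ 2 - x ^ 2 / 2 - y ^ 2 / 2`; the three errors add up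
  -- to at most `3 / 4` of the bound claimed.
  have h : NN (6 * M + 12) m (fun p : ℝ × ℝ => 2 * q ((p.1 + p.2) / 2) - q p.1 / 2 - q p.2 / 2) :=
    (((nq.comp_isAff (f := fun p : ℝ × ℝ => (p.1 + p.2) / 2) (by fun_prop)).prodMk
      ((nq.comp_isAff (f := fun p : ℝ × ℝ => p.1) (by fun_prop)).prodMk
      (nq.comp_isAff (f := fun p : ℝ × ℝ => p.2) (by fun_prop)))).isAff_comp
      (g := fun r : ℝ × ℝ × ℝ => 2 * r.1 - r.2.1 / 2 - r.2.2 / 2) (by fun_prop)).mono (by omega)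
  -- Clamping does not increase the error and keeps the output admissible as a factor of the next
  -- product.
  have hc : NN (6 * M + 12) 1 clamp := (NN.clamp isAff_id).mono (by omega)
  refine ⟨_, hc.comp h, fun p => ⟨clamp_nonneg _, clamp_le_one _⟩, fun x y hx0 hx1 hy0 hy1 => ?_⟩
  have e : x * y = clamp (x * y) :=
    (clamp_of_mem (mul_nonneg hx0 hy0) (mul_le_one₀ hx1 hy0 hy1)).symm
  rw [e]
  refine (abs_clamp_sub_le _ _).trans ?_
  have a := abs_le.1 (hq ((x + y) / 2) (by linarith) (by linarith))
  have b := abs_le.1 (hq x hx0 hx1)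
  have c := abs_le.1 (hq y hy0 hy1)
  rw [abs_le]
  constructor <;> linarith [a.1, a.2, b.1, b.2, c.1, c.2]

/-- Networks of width `O(M)` and depth `O(|α| m)` approximate monomials on the unit cube. -/
theorem exists_monomial {M : ℕ} (hM : 1 ≤ M) (m : ℕ) {d : ℕ} (k : ℕ) (α : Fin d → ℕ)
    (hα : ∑ i, α i = k) :
    ∃ φ : (Fin d → ℝ) → ℝ, NN (6 * M + 12 + 2 * k) (k * (m + 1)) φ ∧
      ∀ r ∈ unitCube d, 0 ≤ φ r ∧ φ r ≤ 1 ∧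
        |φ r - ∏ i, r i ^ α i| ≤ k * (1 / (M : ℝ) ^ 2) ^ m := by
  induction k generalizing α with
  | zero =>
    have h0 : ∀ i, α i = 0 := by simpa using hα
    refine ⟨fun _ => 1, NN.const 1, fun r _ => ⟨zero_le_one, le_rfl, by simp [h0]⟩⟩
  | succ k ih =>
    obtain ⟨i, -, hi⟩ : ∃ i ∈ Finset.univ, 0 < α i := by
      by_contra! h
      have := Finset.sum_nonpos h
      omega
    obtain ⟨β, rfl⟩ : ∃ β : Fin d → ℕ, α = β + Pi.single i 1 :=
      ⟨α - Pi.single i 1, by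
        ext j
        rcases eq_or_ne j i with rfl | hj
        · simp; omega
        · simp [hj]⟩
    have hβ : ∑ j, β j = k := by
      simpa [Finset.sum_add_distrib] using hα
    obtain ⟨g, ng, hg⟩ := ih β hβ
    obtain ⟨μ, nμ, hμ0, hμ⟩ := exists_mul hM m
    have h1 : NN (6 * M + 12 + 2 * k + 2) (k * (m + 1)) (fun r : Fin d → ℝ => (g r, r i)) :=
      ng.prodMk (NN.of_isAff_real (by fun_prop))
    rw [Nat.succ_mul k]
    refine ⟨_, (nμ.mono (w₂ := 6 * M + 12 + 2 * (k + 1)) (by omega)).comp (h1.mono (by omega)), fun r hr => ?_⟩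
    obtain ⟨g0, g1, g2⟩ := hg r hr
    have r0 : 0 ≤ r i := hr.1 i
    have r1 : r i ≤ 1 := hr.2 i
    refine ⟨(hμ0 _).1, (hμ0 _).2, ?_⟩
    have hprod : ∏ j, r j ^ (β + Pi.single i 1 : Fin d → ℕ) j = (∏ j, r j ^ β j) * r i := by
      simp only [Pi.add_apply, pow_add, Finset.prod_mul_distrib]
      congr 1
      rw [Finset.prod_eq_single i (fun j _ hj => by simp [hj]) (by simp)]
      simp
    rw [hprod]
    have h2 := hμ (g r) (r i) g0 g1 r0 r1
    calc |μ (g r, r i) - (∏ j, r j ^ β j) * r i|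
        = |(μ (g r, r i) - g r * r i) + (g r - ∏ j, r j ^ β j) * r i| := by congr 1; ring
      _ ≤ |μ (g r, r i) - g r * r i| + |g r - ∏ j, r j ^ β j| * r i := by
          refine (abs_add_le _ _).trans ?_
          rw [abs_mul, abs_of_nonneg r0]
      _ ≤ (1 / (M : ℝ) ^ 2) ^ m + k * (1 / (M : ℝ) ^ 2) ^ m * 1 := by
          gcongr
      _ = _ := by push_cast; ring

end Monomials

/-! ### Taylor's formula on the cube -/

section Taylor

variable {d : ℕ}

theorem interior_unitCube : (interior (unitCube d)).Nonempty := by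
  rw [unitCube, ← Set.pi_univ_Icc, interior_pi_set Set.finite_univ]
  refine ⟨fun _ => 1 / 2, fun i _ => ?_⟩
  simp only [interior_Icc]
  norm_num

theorem convex_unitCube : Convex ℝ (unitCube d) := convex_Icc 0 1

theorem uniqueDiffOn_unitCube : UniqueDiffOn ℝ (unitCube d) :=
  uniqueDiffOn_convex convex_unitCube interior_unitCube

theorem mem_unitCube {x : Fin d → ℝ} : x ∈ unitCube d ↔ ∀ i, 0 ≤ x i ∧ x i ≤ 1 :=
  ⟨fun h i => ⟨h.1 i, h.2 i⟩, fun h => ⟨fun i => (h i).1, fun i => (h i).2⟩⟩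

theorem update_mem_unitCube {x : Fin d → ℝ} (hx : x ∈ unitCube d) (i : Fin d) {t : ℝ}
    (ht : t ∈ Set.Icc (0 : ℝ) 1) : Function.update x i t ∈ unitCube d := by
  rw [mem_unitCube] at *
  intro j
  rcases eq_or_ne j i with rfl | h
  · simpa using ht
  · simpa [h] using hx j

/-- A line parallel to an axis through a point of the cube meets it in an interval of length 1, so
the one-sided derivative is unique even on the boundary. -/
theorem partialDeriv_eq_fderivWithin {g : (Fin d → ℝ) → ℝ} {x : Fin d → ℝ} (i : Fin d)
    (hx : x ∈ unitCube d) (hg : DifferentiableWithinAt ℝ g (unitCube d) x) :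
    partialDeriv i g x = fderivWithin ℝ g (unitCube d) x (Pi.single i 1) := by
  have h := hg.hasFDerivWithinAt.hasLineDerivWithinAt (Pi.single i 1)
  refine HasDerivWithinAt.derivWithin h ?_
  have e : (fun t : ℝ => x + t • (Pi.single i 1 : Fin d → ℝ)) ⁻¹' unitCube d
      = Set.Icc (-x i) (1 - x i) := by
    ext t
    simp only [Set.mem_preimage, mem_unitCube, Set.mem_Icc, Pi.add_apply, Pi.smul_apply, smul_eq_mul]
    constructor
    · intro h
      have := h i
      simp only [Pi.single_eq_same, mul_one] at this
      constructor <;> linarith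
    · intro h j
      rcases eq_or_ne j i with rfl | hj
      · simp only [Pi.single_eq_same, mul_one]
        constructor <;> linarith
      · simpa [hj] using mem_unitCube.1 hx j
  rw [e]
  have := mem_unitCube.1 hx i
  exact uniqueDiffOn_Icc (by linarith) 0 ⟨by linarith, by linarith⟩

theorem contDiffOn_partialDeriv {g : (Fin d → ℝ) → ℝ} (i : Fin d) {n : ℕ}
    (hg : ContDiffOn ℝ ((n + 1 : ℕ) : WithTop ℕ∞) g (unitCube d)) :
    ContDiffOn ℝ (n : WithTop ℕ∞) (partialDeriv i g) (unitCube d) := by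
  have h := (hg.fderivWithin uniqueDiffOn_unitCube (m := (n : WithTop ℕ∞))
    (by push_cast; exact le_rfl)).clm_apply
    (contDiffOn_const (c := (Pi.single i 1 : Fin d → ℝ)))
  refine h.congr fun x hx => partialDeriv_eq_fderivWithin i hx ?_
  exact hg.differentiableOn (by simp) x hx

theorem hasDerivWithinAt_update {g : (Fin d → ℝ) → ℝ} (i : Fin d)
    (hg : DifferentiableOn ℝ g (unitCube d)) {x : Fin d → ℝ} (hx : x ∈ unitCube d) {t : ℝ}
    (ht : t ∈ Set.Icc (0 : ℝ) 1) :
    HasDerivWithinAt (fun t => g (Function.update x i t))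
      (partialDeriv i g (Function.update x i t)) (Set.Icc 0 1) t := by
  have hm := update_mem_unitCube hx i ht
  have h := (hg _ hm).hasFDerivWithinAt.comp_hasDerivWithinAt t
    (hasDerivAt_update x i t).hasDerivWithinAt fun s hs => update_mem_unitCube hx i hs
  rwa [← partialDeriv_eq_fderivWithin i hm (hg _ hm)] at h

theorem contDiffOn_iterate_partialDeriv {g : (Fin d → ℝ) → ℝ} (i : Fin d) {n k : ℕ}
    (hg : ContDiffOn ℝ ((n + k : ℕ) : WithTop ℕ∞) g (unitCube d)) :
    ContDiffOn ℝ (n : WithTop ℕ∞) ((partialDeriv i)^[k] g) (unitCube d) := by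
  induction k generalizing n with
  | zero => exact hg
  | succ k ih =>
    rw [Function.iterate_succ_apply']
    exact contDiffOn_partialDeriv i (ih (by rwa [Nat.add_right_comm]))

/-- Iterated partial derivatives with respect to the coordinates in a list. -/
noncomputable def listDeriv (l : List (Fin d)) (α : Fin d → ℕ) (f : (Fin d → ℝ) → ℝ) :
    (Fin d → ℝ) → ℝ :=
  l.foldr (fun i g => (partialDeriv i)^[α i] g) f

theorem listDeriv_append (l : List (Fin d)) (i : Fin d) (α : Fin d → ℕ) (f : (Fin d → ℝ) → ℝ) :
    listDeriv (l ++ [i]) α f = listDeriv l α ((partialDeriv i)^[α i] f) := by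
  simp [listDeriv]

theorem listDeriv_congr {l : List (Fin d)} {α β : Fin d → ℕ} (h : ∀ i ∈ l, α i = β i)
    (f : (Fin d → ℝ) → ℝ) : listDeriv l α f = listDeriv l β f :=
  List.foldr_ext _ _ _ fun i hi g => by rw [h i hi]

theorem listDeriv_zero (l : List (Fin d)) (f : (Fin d → ℝ) → ℝ) :
    listDeriv l (fun _ => 0) f = f := by
  simp [listDeriv]

theorem contDiffOn_listDeriv (l : List (Fin d)) (α : Fin d → ℕ) {f : (Fin d → ℝ) → ℝ} {n : ℕ}
    (hf : ContDiffOn ℝ ((n + (l.map α).sum : ℕ) : WithTop ℕ∞) f (unitCube d)) :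
    ContDiffOn ℝ (n : WithTop ℕ∞) (listDeriv l α f) (unitCube d) := by
  induction l generalizing n with
  | nil => simpa [listDeriv] using hf
  | cons a l ih =>
    refine contDiffOn_iterate_partialDeriv a (ih ?_)
    rw [List.map_cons, List.sum_cons, ← add_assoc] at hf
    exact hf

/-- An almost everywhere bound on a continuous function holds everywhere, because the cube lies in
the closure of its interior. -/
theorem abs_le_linftyNorm {g : (Fin d → ℝ) → ℝ} (hg : ContinuousOn g (unitCube d))
    {x : Fin d → ℝ} (hx : x ∈ unitCube d) : |g x| ≤ linftyNorm g := by
  have hc : IsCompact (unitCube d) := isCompact_Icc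
  obtain ⟨C, hC⟩ := hc.exists_bound_of_continuousOn hg
  have hfin : eLpNorm g ∞ (volume.restrict (unitCube d)) ≠ ⊤ := by
    rw [eLpNorm_exponent_top]
    exact (eLpNormEssSup_lt_top_of_ae_bound
      ((ae_restrict_iff' measurableSet_Icc).2 (Filter.Eventually.of_forall hC))).ne
  have hae : ∀ᵐ y ∂(volume.restrict (unitCube d)), |g y| ≤ linftyNorm g := by
    filter_upwards [ae_le_eLpNormEssSup (f := g) (μ := volume.restrict (unitCube d))] with y hy
    rw [← eLpNorm_exponent_top] at hy
    have := ENNReal.toReal_mono hfin hy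
    simpa [linftyNorm] using this
  have heq : Set.EqOn (fun y => max |g y| (linftyNorm g)) (fun _ => linftyNorm g) (unitCube d) := by
    refine Measure.eqOn_of_ae_eq (μ := volume) ?_ ?_ continuousOn_const ?_
    · filter_upwards [hae] with y hy using max_eq_right hy
    · exact (hg.abs).sup continuousOn_const
    · rw [convex_unitCube.closure_interior_eq_closure_of_nonempty_interior interior_unitCube]
      exact subset_closure
  exact (le_max_left _ _).trans (heq hx).le

theorem abs_mixedDeriv_le_csNorm {s : ℕ} {f : (Fin d → ℝ) → ℝ}
    (hf : ContDiffOn ℝ (s : WithTop ℕ∞) f (unitCube d)) {α : Fin d → ℕ} (hα : ∑ i, α i ≤ s)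
    {x : Fin d → ℝ} (hx : x ∈ unitCube d) : |mixedDeriv α f x| ≤ csNorm s f := by
  have hcont : ContinuousOn (mixedDeriv α f) (unitCube d) := by
    refine (contDiffOn_listDeriv (n := s - ∑ i, α i) (List.finRange d) α ?_).continuousOn
    rwa [← Fin.sum_univ_def, Nat.sub_add_cancel hα]
  have hfin : Finite {α : Fin d → ℕ // ∑ i, α i ≤ s} := by
    refine ((Set.finite_Icc (0 : Fin d → ℕ) fun _ => s).subset fun β hβ => ?_).to_subtype
    exact ⟨fun i => Nat.zero_le _, fun i =>
      (Finset.single_le_sum (fun j _ => Nat.zero_le (β j)) (Finset.mem_univ i)).trans hβ⟩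
  exact (abs_le_linftyNorm hcont hx).trans
    (le_ciSup (f := fun α : {α : Fin d → ℕ // ∑ i, α i ≤ s} => linftyNorm (mixedDeriv α.1 f))
      (Set.finite_range _).bddAbove ⟨α, hα⟩)

/-- Taylor's formula in one variable, with a bound on the remainder. -/
theorem abs_sub_taylor_le {a b C : ℝ} (m : ℕ) (F : ℕ → ℝ → ℝ)
    (hF : ∀ k < m, ∀ t ∈ Set.Icc a b, HasDerivWithinAt (F k) (F (k + 1) t) (Set.Icc a b) t)
    (hC : ∀ t ∈ Set.Icc a b, |F m t| ≤ C) {t : ℝ} (ht : t ∈ Set.Icc a b) :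
    |F 0 t - ∑ k ∈ Finset.range m, F k a * (t - a) ^ k / k.factorial|
      ≤ C * (t - a) ^ m / m.factorial := by
  induction m generalizing F t with
  | zero => simpa using hC t ht
  | succ m ih =>
    have hR : ∀ t ∈ Set.Icc a b, HasDerivWithinAt
        (fun t => F 0 t - ∑ k ∈ Finset.range (m + 1), F k a * (t - a) ^ k / k.factorial)
        (F 1 t - ∑ k ∈ Finset.range m, F (k + 1) a * (t - a) ^ k / k.factorial)
        (Set.Icc a b) t := by
      intro t ht
      refine (hF 0 (by omega) t ht).sub ?_
      simp only [Finset.sum_range_succ']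
      simp only [pow_zero, mul_one, Nat.factorial_zero, Nat.cast_one, div_one]
      refine HasDerivWithinAt.add_const _ (HasDerivWithinAt.fun_sum fun k _ => ?_)
      have h := ((((hasDerivAt_id t).sub_const a).pow (k + 1)).const_mul
        (F (k + 1) a)).div_const ((k + 1).factorial : ℝ)
      refine h.hasDerivWithinAt.congr_deriv ?_
      have : (k.factorial : ℝ) ≠ 0 := by exact_mod_cast k.factorial_ne_zero
      have h2 : (k : ℝ) + 1 ≠ 0 := by positivity
      rw [Nat.factorial_succ]
      push_cast
      simp only [id]
      field_simp
    have hB : ∀ t, HasDerivAt (fun t => C * (t - a) ^ (m + 1) / (m + 1).factorial)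
        (C * (t - a) ^ m / m.factorial) t := by
      intro t
      have h := ((((hasDerivAt_id t).sub_const a).pow (m + 1)).const_mul
        C).div_const ((m + 1).factorial : ℝ)
      refine h.congr_deriv ?_
      have : (m.factorial : ℝ) ≠ 0 := by exact_mod_cast m.factorial_ne_zero
      have h2 : (m : ℝ) + 1 ≠ 0 := by positivity
      rw [Nat.factorial_succ]
      push_cast
      simp only [id]
      field_simp
    -- The derivative of the remainder is the remainder of order `m` for the shifted family. By
    -- induction it is at most the derivative of the bound, and both vanish at `a`.
    refine image_norm_le_of_norm_deriv_right_le_deriv_boundary'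
      (f' := fun t => F 1 t - ∑ k ∈ Finset.range m, F (k + 1) a * (t - a) ^ k / k.factorial)
      (B' := fun t => C * (t - a) ^ m / m.factorial)
      (fun t ht => (hR t ht).continuousWithinAt) (fun t ht => ?_) ?_
      (fun t _ => (hB t).continuousAt.continuousWithinAt) (fun t _ => (hB t).hasDerivWithinAt)
      (fun t ht => ?_) ht
    · exact (hR t (Set.Ico_subset_Icc_self ht)).mono_of_mem_nhdsWithin (Icc_mem_nhdsGE_of_mem ht)
    · simp [Finset.sum_range_succ']
    · exact ih (fun k => F (k + 1)) (fun k hk => hF (k + 1) (by omega)) hC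
        (Set.Ico_subset_Icc_self ht)

/-- Substituting the value of one exponent in a sum over multi-indices. -/
theorem sum_box_eq {s m : ℕ} (hm : m ≤ s) (i : Fin d) (G : ℕ → (Fin d → ℕ) → ℝ)
    (hG : ∀ k < m, ∀ α, α i ≠ 0 → G k α = 0) :
    ∑ β ∈ Fintype.piFinset fun _ : Fin d => Finset.range s,
        (if β i < m then G (β i) (Function.update β i 0) else 0)
      = ∑ k ∈ Finset.range m, ∑ α ∈ Fintype.piFinset fun _ : Fin d => Finset.range s, G k α := by
  have h1 : ∀ k ∈ Finset.range m, ∑ α ∈ Fintype.piFinset fun _ : Fin d => Finset.range s, G k α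
      = ∑ α ∈ (Fintype.piFinset fun _ : Fin d => Finset.range s) with α i = 0, G k α := by
    intro k hk
    rw [Finset.sum_filter]
    exact Finset.sum_congr rfl fun α _ => by
      split_ifs with h
      exacts [rfl, hG k (Finset.mem_range.1 hk) α h]
  rw [Finset.sum_congr rfl h1, ← Finset.sum_filter, ← Finset.sum_product']
  refine Finset.sum_nbij' (fun β => (β i, Function.update β i 0))
    (fun p => Function.update p.2 i p.1) ?_ ?_ ?_ ?_ ?_
  · intro β hβ
    simp only [Finset.mem_filter, Fintype.mem_piFinset, Finset.mem_range, Finset.mem_product] at *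
    refine ⟨hβ.2, fun j => ?_, by simp⟩
    rcases eq_or_ne j i with rfl | hj
    · simpa using (Nat.zero_le _).trans_lt (hβ.1 j)
    · simpa [hj] using hβ.1 j
  · rintro ⟨k, α⟩ hp
    simp only [Finset.mem_filter, Fintype.mem_piFinset, Finset.mem_range, Finset.mem_product] at *
    refine ⟨fun j => ?_, by simpa using hp.1⟩
    rcases eq_or_ne j i with rfl | hj
    · simpa using hp.1.trans_le hm
    · simpa [hj] using hp.2.1 j
  · intro β _
    simp
  · rintro ⟨k, α⟩ hp
    simp only [Finset.mem_filter, Finset.mem_product] at hp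
    simp [← hp.2.2]
  · intro β _
    rfl

/-- Induction on the coordinates: expand in the last one, then expand its `k`-th coefficient to
order `m - k` in the others. `listDeriv` applies the last coordinate first, so only derivatives in
the prescribed order occur and their symmetry is not needed. The constant grows by `1 + m * A ≤ (m +
1) * A` for `A = (m + 1) ^ l.length`. -/
theorem exists_taylor_list {s : ℕ} (l : List (Fin d)) (hl : l.Nodup) {m : ℕ} (hm : m ≤ s)
    (hm0 : 1 ≤ m) {g : (Fin d → ℝ) → ℝ} (hg : ContDiffOn ℝ (m : WithTop ℕ∞) g (unitCube d))
    {C : ℝ} (hC : ∀ α : Fin d → ℕ, (l.map α).sum ≤ m → ∀ x ∈ unitCube d, |listDeriv l α g x| ≤ C)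
    {z : Fin d → ℝ} (hz : z ∈ unitCube d) :
    ∃ c : (Fin d → ℕ) → ℝ, (∀ α, |c α| ≤ C) ∧
      (∀ α, c α ≠ 0 → ∑ i, α i < m ∧ ∀ j ∉ l, α j = 0) ∧
      ∀ y ∈ unitCube d, ∀ h, 0 ≤ h → (∀ j ∈ l, z j ≤ y j ∧ y j - z j ≤ h) →
        (∀ j ∉ l, y j = z j) →
        |g y - ∑ α ∈ Fintype.piFinset fun _ : Fin d => Finset.range s,
          c α * ∏ j, (y j - z j) ^ α j| ≤ (m + 1) ^ l.length * C * h ^ m := by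
  induction l using List.reverseRecOn generalizing m g z with
  | nil =>
    have hC0 : |g z| ≤ C := by simpa [listDeriv] using hC (fun _ => 0) (by simp) z hz
    have hC' : 0 ≤ C := (abs_nonneg _).trans hC0
    refine ⟨fun α => if α = 0 then g z else 0, fun α => ?_, fun α hα => ?_, ?_⟩
    · dsimp only
      split_ifs
      exacts [hC0, by simpa using hC']
    · have : α = 0 := by by_contra h; simp [h] at hα
      subst this
      simp; omega
    · intro y _ h hh _ hyz
      have : y = z := funext fun j => hyz j (by simp)
      subst this
      rw [Finset.sum_eq_single 0 (fun α _ hα => by simp [hα])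
        (fun h => (h (by simp; omega)).elim)]
      simp
      positivity
  | append_singleton l i ih =>
    obtain ⟨hl1, -, hl2⟩ := List.nodup_append.1 hl
    have hil : i ∉ l := fun h => hl2 i h i (by simp) rfl
    have hC' : 0 ≤ C := (abs_nonneg _).trans (hC (fun _ => 0) (by simp) z hz)
    have hsub : ∀ k < m, ContDiffOn ℝ ((m - k : ℕ) : WithTop ℕ∞) ((partialDeriv i)^[k] g)
        (unitCube d) := fun k hk =>
      contDiffOn_iterate_partialDeriv i (by rwa [Nat.sub_add_cancel hk.le])
    have hIH := fun (k : ℕ) (hk : k < m) => ih hl1 (m := m - k) (by omega) (by omega) (hsub k hk)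
      (fun α hα x hx => by
        have h1 := hC (Function.update α i k) (by
          rw [List.map_append, List.sum_append, List.map_congr_left (g := α) (fun j hj => by
            rw [Function.update_of_ne]; rintro rfl; exact hil hj)]
          simp; omega) x hx
        rw [listDeriv_append, Function.update_self] at h1
        rwa [listDeriv_congr (β := α) (fun j hj => by
            rw [Function.update_of_ne]; rintro rfl; exact hil hj)] at h1) hz
    have hIH' : ∀ k, ∃ c : (Fin d → ℕ) → ℝ, k < m → _ := fun k =>
      if hk : k < m then (hIH k hk).imp fun _ h _ => h else ⟨fun _ => 0, fun h => (hk h).elim⟩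
    choose c hc using hIH'
    refine ⟨fun β => if β i < m then c (β i) (Function.update β i 0) / (β i).factorial else 0,
      fun β => ?_, fun β hβ => ?_, ?_⟩
    · dsimp only
      split_ifs with h
      · rw [abs_div, Nat.abs_cast]
        refine (div_le_self (abs_nonneg _) ?_).trans ((hc _ h).1 _)
        exact_mod_cast Nat.one_le_iff_ne_zero.2 (Nat.factorial_ne_zero _)
      · simpa using hC'
    · have h : β i < m := by by_contra h; simp [h] at hβ
      have h0 : c (β i) (Function.update β i 0) ≠ 0 := by
        intro h0; simp [h0] at hβ
      obtain ⟨h1, h2⟩ := (hc _ h).2.1 _ h0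
      constructor
      · rw [Finset.sum_update_of_mem (Finset.mem_univ i), zero_add,
          Finset.sdiff_singleton_eq_erase] at h1
        rw [← Finset.add_sum_erase _ _ (Finset.mem_univ i)]
        omega
      · intro j hj
        simp only [List.mem_append, List.mem_singleton, not_or] at hj
        simpa [hj.2] using h2 j hj.1
    · intro y hy h hh hyz hyz'
      set y' := Function.update y i (z i) with hy'
      have hzi := mem_unitCube.1 hz i
      have hyi := mem_unitCube.1 hy i
      have hy'm : y' ∈ unitCube d := update_mem_unitCube hy i ⟨hzi.1, hzi.2⟩
      obtain ⟨hi1, hi2⟩ := hyz i (by simp)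
      have hi0 : 0 ≤ y i - z i := by linarith
      have hsum : ∑ β ∈ Fintype.piFinset fun _ : Fin d => Finset.range s,
          (if β i < m then c (β i) (Function.update β i 0) / (β i).factorial else 0) *
            ∏ j, (y j - z j) ^ β j
          = ∑ k ∈ Finset.range m, (y i - z i) ^ k / k.factorial *
            ∑ α ∈ Fintype.piFinset fun _ : Fin d => Finset.range s,
              c k α * ∏ j, (y' j - z j) ^ α j := by
        simp only [Finset.mul_sum]
        rw [← sum_box_eq hm i (G := fun k α => (y i - z i) ^ k / k.factorial *
          (c k α * ∏ j, (y' j - z j) ^ α j))]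
        · refine Finset.sum_congr rfl fun β _ => ?_
          split_ifs with hβ
          · have e : ∏ j, (y j - z j) ^ β j = (y i - z i) ^ β i *
                ∏ j, (y' j - z j) ^ (Function.update β i 0) j := by
              rw [← Finset.mul_prod_erase Finset.univ _ (Finset.mem_univ i),
                ← Finset.mul_prod_erase Finset.univ (fun j => (y' j - z j) ^ _)
                  (Finset.mem_univ i)]
              simp only [Function.update_self, pow_zero, one_mul]
              congr 1
              refine Finset.prod_congr rfl fun j hj => ?_
              have hj := Finset.ne_of_mem_erase hj
              rw [hy', Function.update_of_ne hj, Function.update_of_ne hj]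
            rw [e]
            ring
          · simp
        · intro k hk α hα
          have : c k α = 0 := by
            by_contra h0
            exact hα (((hc k hk).2.1 α h0).2 i hil)
          simp [this]
      have hT := abs_sub_taylor_le (a := z i) (b := 1) (C := C) m
        (fun k t => (partialDeriv i)^[k] g (Function.update y i t)) (fun k hk t ht => by
          rw [Function.iterate_succ_apply']
          refine (hasDerivWithinAt_update i ((hsub k hk).differentiableOn ?_) hy
            ⟨hzi.1.trans ht.1, ht.2⟩).mono (Set.Icc_subset_Icc_left hzi.1)
          exact_mod_cast (by omega : m - k ≠ 0)) (fun t ht => by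
          have h1 := hC (Pi.single i m) (by
            rw [List.map_append, List.sum_append, List.map_congr_left (g := fun _ => 0)
              (fun j hj => by rw [Pi.single_eq_of_ne]; rintro rfl; exact hil hj)]
            simp) _ (update_mem_unitCube hy i ⟨hzi.1.trans ht.1, ht.2⟩)
          rw [listDeriv_append, Pi.single_eq_same, listDeriv_congr (β := fun _ => 0)
            (fun j hj => by rw [Pi.single_eq_of_ne]; rintro rfl; exact hil hj),
            listDeriv_zero] at h1
          exact h1) ⟨hi1, hyi.2⟩
      simp only [Function.iterate_zero, id, Function.update_eq_self, ← hy'] at hT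
      rw [hsum]
      set S : ℕ → ℝ := fun k => ∑ α ∈ Fintype.piFinset fun _ : Fin d => Finset.range s,
              c k α * ∏ j, (y' j - z j) ^ α j
      have hS : ∀ k ∈ Finset.range m, |(partialDeriv i)^[k] g y' * (y i - z i) ^ k / k.factorial -
          (y i - z i) ^ k / k.factorial * S k| ≤ (m + 1) ^ l.length * C * h ^ m := by
        intro k hk
        have hk := Finset.mem_range.1 hk
        have h1 := (hc k hk).2.2 y' hy'm h hh (fun j hj => by
          rw [hy', Function.update_of_ne (by rintro rfl; exact hil hj)]
          exact hyz j (by simp [hj])) (fun j hj => by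
          rcases eq_or_ne j i with rfl | hji
          · rw [hy', Function.update_self]
          · rw [hy', Function.update_of_ne hji]
            exact hyz' j (by simp [hj, hji]))
        have hfac : (1 : ℝ) ≤ k.factorial := by
          exact_mod_cast Nat.one_le_iff_ne_zero.2 (Nat.factorial_ne_zero _)
        calc _ = (y i - z i) ^ k / k.factorial * |(partialDeriv i)^[k] g y' - S k| := by
              rw [← abs_of_nonneg (show 0 ≤ (y i - z i) ^ k / (k.factorial : ℝ) by positivity),
                ← abs_mul, abs_of_nonneg (show 0 ≤ (y i - z i) ^ k / (k.factorial : ℝ) by positivity)]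
              congr 1
              ring
          _ ≤ h ^ k * ((m + 1) ^ l.length * C * h ^ (m - k)) := by
              refine mul_le_mul ?_ (h1.trans ?_) (abs_nonneg _) (by positivity)
              · exact (div_le_self (by positivity) hfac).trans (pow_le_pow_left₀ hi0 hi2 k)
              · have : ((m - k : ℕ) : ℝ) ≤ m := by exact_mod_cast Nat.sub_le m k
                gcongr
          _ = _ := by
              rw [mul_left_comm, ← pow_add, Nat.add_sub_cancel' hk.le]
      calc |g y - ∑ k ∈ Finset.range m, (y i - z i) ^ k / k.factorial * S k|
          ≤ |g y - ∑ k ∈ Finset.range m, (partialDeriv i)^[k] g y' * (y i - z i) ^ k / k.factorial|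
            + |∑ k ∈ Finset.range m, ((partialDeriv i)^[k] g y' * (y i - z i) ^ k / k.factorial -
              (y i - z i) ^ k / k.factorial * S k)| := by
            rw [Finset.sum_sub_distrib]
            exact abs_sub_le _ _ _
        _ ≤ C * h ^ m + m * ((m + 1) ^ l.length * C * h ^ m) := by
            refine add_le_add (hT.trans ?_) ((Finset.abs_sum_le_sum_abs _ _).trans
              ((Finset.sum_le_sum hS).trans ?_))
            · have hfac : (1 : ℝ) ≤ m.factorial := by
                exact_mod_cast Nat.one_le_iff_ne_zero.2 (Nat.factorial_ne_zero _)
              exact (div_le_self (by positivity) hfac).trans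
                (mul_le_mul_of_nonneg_left (pow_le_pow_left₀ hi0 hi2 m) hC')
            · simp
        _ ≤ (m + 1) ^ l.length * C * h ^ m + m * ((m + 1) ^ l.length * C * h ^ m) := by
            have : (1 : ℝ) ≤ (m + 1) ^ l.length := one_le_pow₀ (by simp)
            gcongr
            exact le_mul_of_one_le_left hC' this
        _ = _ := by
            rw [List.length_append, List.length_singleton, pow_succ]
            ring

/-- Taylor's formula on the unit cube with the remainder bounded by the `C^s` norm. -/
theorem exists_taylor {s : ℕ} (hs : 1 ≤ s) {f : (Fin d → ℝ) → ℝ}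
    (hf : ContDiffOn ℝ (s : WithTop ℕ∞) f (unitCube d)) {z : Fin d → ℝ} (hz : z ∈ unitCube d) :
    ∃ c : (Fin d → ℕ) → ℝ, (∀ α, |c α| ≤ csNorm s f) ∧ (∀ α, c α ≠ 0 → ∑ i, α i < s) ∧
      ∀ y ∈ unitCube d, ∀ h, 0 ≤ h → (∀ j, z j ≤ y j ∧ y j - z j ≤ h) →
        |f y - ∑ α ∈ Fintype.piFinset fun _ : Fin d => Finset.range s,
          c α * ∏ j, (y j - z j) ^ α j| ≤ (s + 1) ^ d * csNorm s f * h ^ s := by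
  obtain ⟨c, h1, h2, h3⟩ := exists_taylor_list (List.finRange d) (List.nodup_finRange d) le_rfl hs
    hf (C := csNorm s f) (fun α hα x hx => abs_mixedDeriv_le_csNorm hf
      (by rwa [Fin.sum_univ_def]) hx) hz
  refine ⟨c, h1, fun α hα => (h2 α hα).1, fun y hy h hh hyz => ?_⟩
  have := h3 y hy h hh (fun j _ => hyz j) (fun j hj => (hj (List.mem_finRange j)).elim)
  rwa [List.length_finRange] at this

end Taylor

/-! ### The mesh and the local polynomials -/

section Cells

variable {d : ℕ}

theorem HasDigits.mono {M w ℓ w' ℓ' : ℕ} (h : HasDigits M w ℓ) (hw : w ≤ w') (hℓ : ℓ ≤ ℓ')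
    (h2 : 2 ≤ w') : HasDigits M w' ℓ' := fun η hη => by
  obtain ⟨φ, n, H⟩ := h η hη
  exact ⟨φ, (n.mono hw).pad h2 hℓ, H⟩

/-- For `d ≥ 2` the exponent is at most 1, so the floor does not exceed `n` and a single wide or
deep digit network suffices. Rounding costs a factor 2. -/
theorem floor_rpow_spec {d n : ℕ} (hd : 2 ≤ d) (hn : 1 ≤ n) :
    1 ≤ ⌊(n : ℝ) ^ (2 / d : ℝ)⌋₊ ∧ ⌊(n : ℝ) ^ (2 / d : ℝ)⌋₊ ≤ n ∧
      ⌊(n : ℝ) ^ (2 / d : ℝ)⌋₊ ^ d ≤ n * n ∧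
      (n : ℝ) ^ (2 / d : ℝ) ≤ 2 * ⌊(n : ℝ) ^ (2 / d : ℝ)⌋₊ := by
  have hn' : (1 : ℝ) ≤ n := by exact_mod_cast hn
  have hd' : (2 : ℝ) ≤ d := by exact_mod_cast hd
  have h1 : (1 : ℝ) ≤ (n : ℝ) ^ (2 / d : ℝ) := Real.one_le_rpow hn' (by positivity)
  have h2 : (⌊(n : ℝ) ^ (2 / d : ℝ)⌋₊ : ℝ) ≤ (n : ℝ) ^ (2 / d : ℝ) := Nat.floor_le (by positivity)
  have h3 := Nat.lt_floor_add_one ((n : ℝ) ^ (2 / d : ℝ))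
  have h4 : 1 ≤ ⌊(n : ℝ) ^ (2 / d : ℝ)⌋₊ := Nat.le_floor (by simpa using h1)
  refine ⟨h4, ?_, ?_, ?_⟩
  · have : (n : ℝ) ^ (2 / d : ℝ) ≤ (n : ℝ) ^ (1 : ℝ) :=
      Real.rpow_le_rpow_of_exponent_le hn' (by rw [div_le_one (by linarith)]; exact hd')
    rw [Real.rpow_one] at this
    exact_mod_cast h2.trans this
  · have h5 := pow_le_pow_left₀ (by positivity) h2 d
    rw [← Real.rpow_mul_natCast (by positivity), div_mul_cancel₀ _ (by positivity)] at h5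
    have h6 : (n : ℝ) ^ (2 : ℝ) = n * n := by
      rw [show (2 : ℝ) = (2 : ℕ) by norm_num, Real.rpow_natCast, sq]
    rw [h6] at h5
    exact_mod_cast h5
  · have : (1 : ℝ) ≤ ⌊(n : ℝ) ^ (2 / d : ℝ)⌋₊ := by exact_mod_cast h4
    linarith

/-- A mesh of the cube with at most `(N * L)^2` cells that a small network can resolve. -/
theorem exists_mesh {N L : ℕ} (hd : 1 ≤ d) (hN : 1 ≤ N) (hL : 1 ≤ L) :
    ∃ K : ℕ, 1 ≤ K ∧ K ^ d ≤ N * (N * (L * L)) ∧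
      (N : ℝ) ^ (2 / d : ℝ) * (L : ℝ) ^ (2 / d : ℝ) ≤ 8 * K ∧
      HasDigits K (2 * N + 12) (2 * L + 2) := by
  rcases hd.eq_or_lt with rfl | hd
  -- For `d = 1` the mesh has `(N * L) ^ 2` intervals, too many for one digit in `N` and one in `L`;
  -- four digits are read.
  · refine ⟨N * (N * (L * L)), Nat.one_le_iff_ne_zero.2 (by positivity), by simp, ?_,
      ((hasDigits_wide N).mul ((hasDigits_wide N).mul
        ((hasDigits_deep L).mul (hasDigits_deep L)))).mono (by omega) (by omega) (by omega)⟩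
    rw [show ((2 : ℝ) / (1 : ℕ)) = (2 : ℕ) by norm_num, Real.rpow_natCast, Real.rpow_natCast]
    push_cast
    have : (0 : ℝ) ≤ N * (N * (L * L)) := by positivity
    nlinarith
  · obtain ⟨a1, a2, a3, a4⟩ := floor_rpow_spec hd hN
    obtain ⟨b1, b2, b3, b4⟩ := floor_rpow_spec hd hL
    refine ⟨_, Nat.mul_le_mul a1 b1, ?_, ?_, ((hasDigits_wide _).mul (hasDigits_deep _)).mono
      (by omega) (by omega) (by omega)⟩
    · rw [mul_pow]
      calc _ ≤ N * N * (L * L) := Nat.mul_le_mul a3 b3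
        _ = _ := by ring
    · push_cast
      calc _ ≤ _ := mul_le_mul a4 b4 (by positivity) (by positivity)
        _ ≤ _ := by
          have : (0 : ℝ) ≤ ⌊(N : ℝ) ^ (2 / d : ℝ)⌋₊ * ⌊(L : ℝ) ^ (2 / d : ℝ)⌋₊ := by positivity
          nlinarith

/-- Approximation of a smooth function away from the faces of the mesh cells. -/
theorem exists_approx_on_cells {s : ℕ} (hs : 1 ≤ s) {f : (Fin d → ℝ) → ℝ}
    (hf : ContDiffOn ℝ (s : WithTop ℕ∞) f (unitCube d)) {N L : ℕ} (hN : 1 ≤ N) (hL : 1 ≤ L)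
    {K w ℓ : ℕ} (hK : 1 ≤ K) (hKd : K ^ d ≤ N * (N * (L * L))) (hdig : HasDigits K w ℓ)
    (P Q m : ℕ) {δ : ℝ} (hδ : 0 < δ) :
    ∃ φ : (Fin d → ℝ) → ℝ,
      NN (max (d * (w + 2)) (s ^ d * max (6 * N + 20 + 2 * s) (P * (6 * N + 15) + 8)))
        (ℓ + (s * (m + 1) + Q * (6 * L + 3))) φ ∧
      ∀ x ∈ unitCube d, (∀ i, ∃ k, Cell K δ (x i) k) →
        |φ x - f x| ≤ s ^ d * (csNorm s f *
          (2 * (1 / 2) ^ (Q * P) + s * (1 / ((N + 1 : ℕ) : ℝ) ^ 2) ^ m)) +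
          (s + 1) ^ d * csNorm s f * (1 / K) ^ s := by
  have hK' : (0 : ℝ) < K := by exact_mod_cast hK
  have hzc : ∀ κ : Fin d → Fin K, (fun i => ((κ i : ℕ) : ℝ) / K) ∈ unitCube d := fun κ =>
    mem_unitCube.2 fun i => ⟨by positivity, by
      rw [div_le_one hK']; exact_mod_cast (κ i).2.le⟩
  choose c hc1 hc2 hc3 using fun κ => exists_taylor hs hf (hzc κ)
  set C := csNorm s f with hC
  have hC0 : 0 ≤ C := (abs_nonneg _).trans (hc1 (fun _ => ⟨0, hK⟩) 0)
  obtain ⟨D, nD, hD⟩ := hdig δ hδ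
  -- Coefficients are moved from `[-C, C]` to `[0, 1]`. For `C = 0` the quotient is 0, and `c = C *
  -- (2 * ξ - 1)` still holds since `c = 0`.
  let ξ : (Fin d → ℕ) → ℕ → ℝ := fun α i =>
    if h : i < K ^ d then (c (finFunctionFinEquiv.symm ⟨i, h⟩) α / C + 1) / 2 else 0
  have hdiv : ∀ κ α, -1 ≤ c κ α / C ∧ c κ α / C ≤ 1 := fun κ α => by
    rw [← abs_le, abs_div, abs_of_nonneg hC0]
    exact div_le_one_of_le₀ (hc1 κ α) hC0
  have hξ0 : ∀ α i, 0 ≤ ξ α i := fun α i => by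
    dsimp only [ξ]
    split_ifs with h
    · linarith [(hdiv (finFunctionFinEquiv.symm ⟨i, h⟩) α).1]
    · exact le_rfl
  have hξ1 : ∀ α i, ξ α i ≤ 1 := fun α i => by
    dsimp only [ξ]
    split_ifs with h
    · linarith [(hdiv (finFunctionFinEquiv.symm ⟨i, h⟩) α).2]
    · exact zero_le_one
  choose Φ nΦ hΦ using fun α => exists_coefficient_mul hN hL P Q (ξ α) (hξ0 α) (hξ1 α)
  choose g ng hg using fun α : Fin d → ℕ =>
    exists_monomial (Nat.le_add_left 1 N) m (∑ i, α i) α rfl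
  set A : Finset (Fin d → ℕ) :=
    (Fintype.piFinset fun _ : Fin d => Finset.range s).filter fun α => ∑ i, α i < s with hA
  have hAcard : A.card ≤ s ^ d := (Finset.card_filter_le _ _).trans (by simp)
  have n1 : NN (d * (w + 2)) ℓ (fun x : Fin d → ℝ =>
      ((∑ i, D (x i) * (K : ℝ) ^ (i : ℕ)), fun i => K * x i - D (x i))) := by
    have h := NN.pi (w := w + 2) (ℓ := ℓ) (f := fun (i : Fin d) (x : Fin d → ℝ) => (D (x i), x i))
      fun i => (nD.comp_isAff (by fun_prop)).prodMk (NN.of_isAff_real (by fun_prop))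
    exact h.isAff_comp (g := fun y : Fin d → ℝ × ℝ =>
      ((∑ i, (y i).1 * (K : ℝ) ^ (i : ℕ)), fun i => K * (y i).2 - (y i).1)) (by fun_prop)
  -- By `c = C * (2 * ξ - 1)`, the product `c * g` is `C * (2 * (ξ * g) - g)`. The power of `K`
  -- comes from `x - k / K = r / K`.
  have n2 : ∀ α ∈ A, NN (max (6 * N + 20 + 2 * s) (P * (6 * N + 15) + 8))
      (s * (m + 1) + Q * (6 * L + 3)) (fun p : ℝ × (Fin d → ℝ) =>
        C / K ^ (∑ i, α i) * (2 * Φ α (p.1, g α p.2) - g α p.2)) := by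
    intro α hα
    have hαs : ∑ i, α i < s := (Finset.mem_filter.1 hα).2
    have h0 : NN (6 * (N + 1) + 12 + 2 * s) (s * (m + 1)) (g α) :=
      ((ng α).mono (by omega)).pad (by omega) (Nat.mul_le_mul_right _ hαs.le)
    have h1 : NN (2 + (6 * (N + 1) + 12 + 2 * s)) (s * (m + 1))
        (fun p : ℝ × (Fin d → ℝ) => (p.1, g α p.2)) :=
      (NN.of_isAff_real (by fun_prop)).prodMk
        (h0.comp_isAff (f := fun p : ℝ × (Fin d → ℝ) => p.2) (by fun_prop))
    have h2 : NN (P * (6 * N + 15) + 6 + 2) (Q * (6 * L + 3))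
        (fun q : ℝ × ℝ => (Φ α q, q.2)) :=
      (nΦ α).prodMk (NN.of_isAff_real (by fun_prop))
    exact ((h2.comp_max h1).isAff_comp
      (g := fun q : ℝ × ℝ => C / K ^ (∑ i, α i) * (2 * q.1 - q.2)) (by fun_prop)).mono (by omega)
  have n3 := (NN.sum A n2).mono (Nat.mul_le_mul_right _ hAcard)
  refine ⟨_, n3.comp_max n1, fun x hx hcell => ?_⟩
  choose k hk using hcell
  let κ : Fin d → Fin K := fun i => ⟨k i, (hk i).1⟩
  have hDk : ∀ i, D (x i) = k i := fun i => hD _ _ (hk i)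
  set r : Fin d → ℝ := fun i => K * x i - k i with hr
  have hrm : r ∈ unitCube d := mem_unitCube.2 fun i => by
    obtain ⟨h1, h2, h3⟩ := hk i
    refine ⟨by simp only [hr]; linarith, ?_⟩
    simp only [hr]
    rcases (Nat.succ_le_of_lt h1).eq_or_lt with h | h
    · have hx1 := (mem_unitCube.1 hx i).2
      have : (K : ℝ) = k i + 1 := by exact_mod_cast h.symm
      have : (K : ℝ) * x i ≤ K := mul_le_of_le_one_right hK'.le hx1
      linarith
    · linarith [h3 h]
  have hidx : (∑ i, (k i : ℝ) * (K : ℝ) ^ (i : ℕ)) = ((finFunctionFinEquiv κ : Fin (K ^ d)) : ℕ) := by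
    rw [finFunctionFinEquiv_apply]
    push_cast
    rfl
  simp only [hDk, hidx]
  set i₀ : ℕ := ((finFunctionFinEquiv κ : Fin (K ^ d)) : ℕ) with hi₀
  have hi₀lt : i₀ < K ^ d := (finFunctionFinEquiv κ).2
  have hξκ : ∀ α, C * (2 * ξ α i₀ - 1) = c κ α := by
    intro α
    have e : ξ α i₀ = (c κ α / C + 1) / 2 := by
      simp only [ξ]
      rw [dif_pos hi₀lt]
      simp only [hi₀, Fin.eta, Equiv.symm_apply_apply]
    rw [e]
    rcases hC0.eq_or_lt with h | h
    · have : c κ α = 0 := abs_nonpos_iff.1 ((hc1 κ α).trans h.symm.le)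
      rw [this, ← h]; ring
    · field_simp; ring
  have hT := hc3 κ x hx (1 / K) (by positivity) fun j => by
    have := mem_unitCube.1 hrm j
    simp only [hr] at this
    constructor
    · rw [div_le_iff₀ hK']; simp only [κ]; linarith
    · rw [sub_le_iff_le_add, ← add_div, le_div_iff₀ hK']; simp only [κ]; linarith
  have hsum : ∑ α ∈ Fintype.piFinset fun _ : Fin d => Finset.range s,
      c κ α * ∏ j, (x j - ((κ j : ℕ) : ℝ) / K) ^ α j
      = ∑ α ∈ A, c κ α / K ^ (∑ i, α i) * ∏ j, r j ^ α j := by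
    rw [hA, Finset.sum_filter]
    refine Finset.sum_congr rfl fun α _ => ?_
    split_ifs with h
    · have : ∀ j, x j - ((κ j : ℕ) : ℝ) / K = r j / K := fun j => by
        simp only [hr, κ]; field_simp
      simp only [this, div_pow, Finset.prod_div_distrib, Finset.prod_pow_eq_pow_sum]
      ring
    · have : c κ α = 0 := by
        by_contra h0
        exact h (hc2 κ α h0)
      rw [this, zero_mul]
  rw [hsum] at hT
  have hterm : ∀ α ∈ A, |C / K ^ (∑ i, α i) * (2 * Φ α (i₀, g α r) - g α r) -
      c κ α / K ^ (∑ i, α i) * ∏ j, r j ^ α j|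
      ≤ C * (2 * (1 / 2) ^ (Q * P) + s * (1 / ((N + 1 : ℕ) : ℝ) ^ 2) ^ m) := by
    intro α hα
    have hαs : ∑ i, α i < s := (Finset.mem_filter.1 hα).2
    obtain ⟨g0, g1, g2⟩ := hg α r hrm
    have h1 := hΦ α i₀ (g α r) (hi₀lt.trans_le hKd) g0 g1
    have h2 : |2 * ξ α i₀ - 1| ≤ 1 := abs_le.2
      ⟨by linarith [hξ0 α i₀], by linarith [hξ1 α i₀]⟩
    have hKp : (1 : ℝ) ≤ (K : ℝ) ^ (∑ i, α i) := one_le_pow₀ (by exact_mod_cast hK)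
    have h3 : (((∑ i, α i : ℕ) : ℝ)) ≤ s := by exact_mod_cast hαs.le
    rw [← hξκ α]
    calc _ = C / K ^ (∑ i, α i) * |2 * (Φ α (i₀, g α r) - ξ α i₀ * g α r) +
          (2 * ξ α i₀ - 1) * (g α r - ∏ j, r j ^ α j)| := by
          rw [← abs_of_nonneg (show 0 ≤ C / (K : ℝ) ^ (∑ i, α i) by positivity), ← abs_mul,
            abs_of_nonneg (show 0 ≤ C / (K : ℝ) ^ (∑ i, α i) by positivity)]
          congr 1
          ring
      _ ≤ C * (2 * (1 / 2) ^ (Q * P) + s * (1 / ((N + 1 : ℕ) : ℝ) ^ 2) ^ m) := by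
          refine mul_le_mul (div_le_self hC0 hKp) ((abs_add_le _ _).trans (add_le_add ?_ ?_))
            (abs_nonneg _) hC0
          · rw [abs_mul, abs_two]; linarith
          · rw [abs_mul]
            calc _ ≤ 1 * ((∑ i, α i : ℕ) * (1 / ((N + 1 : ℕ) : ℝ) ^ 2) ^ m) :=
                  mul_le_mul h2 g2 (abs_nonneg _) zero_le_one
              _ ≤ _ := by rw [one_mul]; gcongr
  calc _ ≤ |∑ α ∈ A, C / K ^ (∑ i, α i) * (2 * Φ α (i₀, g α r) - g α r) -
        ∑ α ∈ A, c κ α / K ^ (∑ i, α i) * ∏ j, r j ^ α j| +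
        |∑ α ∈ A, c κ α / K ^ (∑ i, α i) * ∏ j, r j ^ α j - f x| := abs_sub_le _ _ _
    _ ≤ _ := by
        refine add_le_add ?_ (by rw [abs_sub_comm]; exact hT)
        rw [← Finset.sum_sub_distrib]
        refine (Finset.abs_sum_le_sum_abs _ _).trans ((Finset.sum_le_sum hterm).trans ?_)
        rw [Finset.sum_const, nsmul_eq_mul]
        have : (A.card : ℝ) ≤ (s : ℝ) ^ d := by exact_mod_cast hAcard
        gcongr

end Cells

/-! ### From the mesh cells to the whole cube by medians -/

section Extension

variable {d : ℕ}

/-- Clamping sends points left of 0 into the first cell and points right of 1 into the closed last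
one, so a bad point lies in a slab just left of a mesh point. -/
theorem exists_between_of_not_cell {K : ℕ} (hK : 1 ≤ K) {δ t : ℝ} (hδ : δ ≤ 1)
    (h : ¬ ∃ k, Cell K δ (clamp t) k) : ∃ k : ℕ, (k : ℝ) + 1 - δ < K * t ∧ K * t < k + 1 := by
  have hK' : (0 : ℝ) < K := by exact_mod_cast hK
  have h0 := clamp_nonneg t
  by_cases hlt : K * clamp t < K
  · have hlt1 : clamp t < 1 := by
      by_contra h1; push Not at h1; nlinarith
    have hfl := Nat.floor_le (show 0 ≤ K * clamp t by positivity)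
    have hfl' := Nat.lt_floor_add_one (K * clamp t)
    have hkK : ⌊K * clamp t⌋₊ < K := (Nat.floor_lt (by positivity)).2 hlt
    have h1 : (⌊K * clamp t⌋₊ : ℝ) + 1 - δ < K * clamp t := by
      by_contra h1
      exact h ⟨⌊K * clamp t⌋₊, hkK, hfl, fun _ => not_lt.1 h1⟩
    rcases le_total t 0 with ht | ht
    · have : clamp t = 0 := by
        rw [clamp_eq, min_eq_right (by linarith), max_eq_left ht]
      rw [this, mul_zero, Nat.floor_zero, Nat.cast_zero] at h1
      linarith
    · have : clamp t = t := by
        rcases le_total t 1 with h2 | h2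
        · exact clamp_of_mem ht h2
        · rw [clamp_eq, min_eq_left h2] at hlt1
          simp at hlt1
      rw [this] at h1 hfl'
      exact ⟨_, h1, hfl'⟩
  · refine (h ⟨K - 1, by omega, ?_, fun h => by omega⟩).elim
    rw [Nat.cast_sub hK]
    push_cast
    linarith

/-- After scaling by `K`, a slab has width `K * e / 2`, less than a shift, and distinct slabs are at
least `1 - K * e / 2` apart, more than two shifts. Hence two of `t - e, t, t + e` are never both
bad. -/
theorem mesh_separated {K : ℕ} {e a b δ : ℝ} (hKe : 4 * (K * e) ≤ 1)
    (hδ : δ = K * e / 2)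
    (ha : ∃ k : ℕ, (k : ℝ) + 1 - δ < K * a ∧ K * a < k + 1)
    (hb : ∃ k : ℕ, (k : ℝ) + 1 - δ < K * b ∧ K * b < k + 1)
    (h1 : e ≤ b - a) (h2 : b - a ≤ 2 * e) : False := by
  obtain ⟨k, hk1, hk2⟩ := ha
  obtain ⟨j, hj1, hj2⟩ := hb
  have hK0 : (0 : ℝ) ≤ K := Nat.cast_nonneg K
  have e1 := mul_le_mul_of_nonneg_left h1 hK0
  have e2 := mul_le_mul_of_nonneg_left h2 hK0
  rcases lt_trichotomy k j with h | rfl | h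
  · have : (k : ℝ) + 1 ≤ j := by exact_mod_cast h
    linarith
  · linarith
  · have : (j : ℝ) + 1 ≤ k := by exact_mod_cast h
    linarith

theorem two_good_of_three {G : ℝ → Prop} {e t : ℝ} (he : 0 ≤ e)
    (h : ∀ a b, ¬ G a → ¬ G b → e ≤ b - a → b - a ≤ 2 * e → False) :
    (G (t - e) ∧ G t) ∨ (G (t - e) ∧ G (t + e)) ∨ (G t ∧ G (t + e)) := by
  have h1 : ¬ (¬ G (t - e) ∧ ¬ G t) := fun g => h _ _ g.1 g.2 (by linarith) (by linarith)
  have h2 : ¬ (¬ G (t - e) ∧ ¬ G (t + e)) := fun g => h _ _ g.1 g.2 (by linarith) (by linarith)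
  have h3 : ¬ (¬ G t ∧ ¬ G (t + e)) := fun g => h _ _ g.1 g.2 (by linarith) (by linarith)
  tauto

theorem clamp_mem_unitCube (x : Fin d → ℝ) : (fun i => clamp (x i)) ∈ unitCube d :=
  mem_unitCube.2 fun _ => ⟨clamp_nonneg _, clamp_le_one _⟩

/-- An approximation away from thin slabs around the mesh faces can be extended to the whole cube
by taking medians of shifted copies. -/
theorem exists_extension {f : (Fin d → ℝ) → ℝ} (hf : ContinuousOn f (unitCube d)) {K : ℕ}
    (hK : 1 ≤ K) {W D : ℕ} (hW : 3 ≤ W) (hWd : 2 * d ≤ W) {ε τ : ℝ} (hτ : 0 < τ)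
    (h : ∀ δ : ℝ, 0 < δ → ∃ φ : (Fin d → ℝ) → ℝ, NN W D φ ∧
      ∀ x ∈ unitCube d, (∀ i, ∃ k, Cell K δ (x i) k) → |φ x - f x| ≤ ε) :
    ∃ φ : (Fin d → ℝ) → ℝ, NN (3 ^ d * W) (1 + D + 2 * d) φ ∧
      ∀ x ∈ unitCube d, |φ x - f x| ≤ ε + τ := by
  have hK' : (0 : ℝ) < K := by exact_mod_cast hK
  set τ' : ℝ := τ / (d + 1)
  have hτ' : 0 < τ' := by positivity
  obtain ⟨ρ, hρ, hρf⟩ := Metric.uniformContinuousOn_iff.1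
    ((isCompact_Icc : IsCompact (unitCube d)).uniformContinuousOn_of_continuous hf) τ' hτ'
  obtain ⟨e, he, heρ, heK⟩ : ∃ e : ℝ, 0 < e ∧ e < ρ ∧ 4 * (K * e) ≤ 1 := by
    refine ⟨min (ρ / 2) (1 / (4 * K)), by positivity, (min_le_left _ _).trans_lt (by linarith), ?_⟩
    have : min (ρ / 2) (1 / (4 * (K : ℝ))) ≤ 1 / (4 * K) := min_le_right _ _
    calc _ ≤ 4 * (K * (1 / (4 * (K : ℝ)))) := by gcongr
      _ = 1 := by field_simp
  have hKe : 0 < K * e := by positivity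
  obtain ⟨φ, nφ, hφ⟩ := h (K * e / 2) (by positivity)
  set G : ℝ → Prop := fun t => ∃ k, Cell K (K * e / 2) (clamp t) k
  -- Composition with the clamp makes shifted arguments outside the cube legitimate.
  set f' : (Fin d → ℝ) → ℝ := fun x => f fun i => clamp (x i)
  have hshift : ∀ (x : Fin d → ℝ) (i : Fin d) (v : ℝ), |v| ≤ e →
      |f' (x + Pi.single i v) - f' x| ≤ τ' := by
    intro x i v hv
    have := hρf _ (clamp_mem_unitCube (x + Pi.single i v)) _ (clamp_mem_unitCube x) (by
      rw [dist_pi_lt_iff hρ]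
      intro j
      refine (abs_clamp_sub_le _ _).trans_lt (lt_of_le_of_lt ?_ heρ)
      rcases eq_or_ne j i with rfl | hj
      · simpa using hv
      · simpa [hj] using he.le)
    exact this.le
  -- After `j` stages only the coordinates from `j` on must be good. A stage takes the median over
  -- shifts of one coordinate: three copies, two more layers and an additional error `τ'`.
  have key : ∀ j ≤ d, ∃ ψ : (Fin d → ℝ) → ℝ, NN (3 ^ j * W) (1 + D + 2 * j) ψ ∧
      ∀ x : Fin d → ℝ, (∀ i : Fin d, j ≤ i → G (x i)) → |ψ x - f' x| ≤ ε + j * τ' := by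
    intro j
    induction j with
    | zero =>
      intro _
      have hc : NN W 1 (fun (x : Fin d → ℝ) (i : Fin d) => clamp (x i)) :=
        (NN.pi fun i => NN.clamp (by fun_prop)).mono (by omega)
      refine ⟨_, (nφ.comp hc).mono (by simp), fun x hx => ?_⟩
      simpa using hφ _ (clamp_mem_unitCube x) fun i => hx i (Nat.zero_le _)
    | succ j ih =>
      intro hj
      obtain ⟨ψ, nψ, hψ⟩ := ih (by omega)
      let i : Fin d := ⟨j, hj⟩
      have nshift : ∀ v : ℝ, NN (3 ^ j * W) (1 + D + 2 * j)
          (fun x : Fin d → ℝ => ψ (x + Pi.single i v)) := fun v =>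
        nψ.comp_isAff (f := fun x : Fin d → ℝ => x + Pi.single i v) (isAff_id.add (isAff_const _))
      have n3 : NN (3 ^ (j + 1) * W) (1 + D + 2 * j) (fun x : Fin d → ℝ =>
          (ψ (x + Pi.single i (-e)), ψ (x + Pi.single i 0), ψ (x + Pi.single i e))) :=
        ((nshift _).prodMk ((nshift _).prodMk (nshift _))).mono (by rw [pow_succ]; linarith)
      have hW3 : 7 ≤ 3 ^ (j + 1) * W := by
        have : 1 ≤ 3 ^ j := Nat.one_le_pow _ _ (by norm_num)
        rw [pow_succ]
        nlinarith
      refine ⟨_, (NN.mid.mono hW3).comp n3, fun x hx => ?_⟩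
      have hval : ∀ v : ℝ, |v| ≤ e → G (x i + v) →
          ψ (x + Pi.single i v) ∈ Set.Icc (f' x - (ε + (j + 1) * τ')) (f' x + (ε + (j + 1) * τ')) := by
        intro v hv hg
        have h1 := hψ (x + Pi.single i v) (fun i' hi' => by
          rcases eq_or_ne i' i with rfl | hne
          · simpa using hg
          · have : (i' : ℕ) ≠ j := fun h => hne (Fin.ext h)
            simpa [hne] using hx i' (by omega))
        have h2 := hshift x i v hv
        rw [abs_le] at h1 h2
        constructor <;> linarith [h1.1, h1.2, h2.1, h2.2]
      have h3 := two_good_of_three (G := G) (e := e) (t := x i) he.le fun a b ha hb hab hab' =>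
        mesh_separated heK rfl (exists_between_of_not_cell hK (by linarith) ha)
          (exists_between_of_not_cell hK (by linarith) hb) hab hab'
      have a1 := hval (-e) (by rw [abs_neg, abs_of_pos he])
      have a2 := hval 0 (by simpa using he.le)
      have a3 := hval e (by rw [abs_of_pos he])
      rw [← sub_eq_add_neg] at a1
      rw [add_zero] at a2
      have := mid_mem (h3.imp (fun h => ⟨a1 h.1, a2 h.2⟩) fun h =>
        h.imp (fun h => ⟨a1 h.1, a3 h.2⟩) fun h => ⟨a2 h.1, a3 h.2⟩)
      rw [abs_le]
      push_cast
      constructor <;> linarith [this.1, this.2]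
  obtain ⟨ψ, nψ, hψ⟩ := key d le_rfl
  refine ⟨ψ, nψ, fun x hx => ?_⟩
  have h1 := hψ x fun i hi => absurd i.2 (not_lt.2 hi)
  have h2 : f' x = f x := congrArg f <| funext fun i =>
    clamp_of_mem (mem_unitCube.1 hx i).1 (mem_unitCube.1 hx i).2
  rw [h2] at h1
  refine h1.trans ?_
  have : d * τ' ≤ τ := by
    simp only [τ']
    rw [mul_div_assoc', div_le_iff₀ (by positivity)]
    nlinarith
  linarith

theorem clog_le_logb_add_one {n : ℕ} (hn : 1 ≤ n) : (Nat.clog 2 n : ℝ) ≤ Real.logb 2 n + 1 := by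
  have h := Nat.ceil_lt_add_one (Real.logb_nonneg one_lt_two
    (show (1 : ℝ) ≤ n by exact_mod_cast hn))
  have e := Real.natCeil_logb_natCast 2 n
  push_cast at e
  rw [e] at h
  exact h.le

theorem rpow_le_two_pow_clog {n s : ℕ} (hd : 1 ≤ d) (hn : 1 ≤ n) :
    (n : ℝ) ^ (2 * (s : ℝ) / d) ≤ (n : ℝ) ^ (2 * s) ∧
      (n : ℝ) ^ (2 * (s : ℝ) / d) ≤ 2 ^ (Nat.clog 2 n * (2 * s)) := by
  have hn' : (1 : ℝ) ≤ n := by exact_mod_cast hn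
  have hd' : (1 : ℝ) ≤ d := by exact_mod_cast hd
  have h1 : (n : ℝ) ^ (2 * (s : ℝ) / d) ≤ (n : ℝ) ^ (2 * s) := by
    rw [← Real.rpow_natCast]
    refine Real.rpow_le_rpow_of_exponent_le hn' ?_
    push_cast
    exact div_le_self (by positivity) hd'
  refine ⟨h1, h1.trans ?_⟩
  rw [pow_mul (2 : ℝ)]
  refine pow_le_pow_left₀ (by positivity) ?_ _
  exact_mod_cast Nat.le_pow_clog one_lt_two n

end Extension

/-! ### Counting width, depth and error -/

section Rates

theorem width_le {d s N : ℕ} (hd : 1 ≤ d) (hs : 1 ≤ s) (hN : 1 ≤ N) :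
    ((3 ^ d * max (max 3 (2 * d)) (max (d * (2 * N + 12 + 2)) (s ^ d *
      max (6 * N + 20 + 2 * s) ((s * (Nat.clog 2 N + 1)) * (6 * N + 15) + 8))) : ℕ) : ℝ)
      ≤ (17 * (s : ℝ) ^ (d + 1) * 3 ^ d * d) * (N + 2) * Real.logb 2 (8 * N) := by
  have hN' : (1 : ℝ) ≤ N := by exact_mod_cast hN
  have hd' : (1 : ℝ) ≤ d := by exact_mod_cast hd
  have hs' : (1 : ℝ) ≤ s := by exact_mod_cast hs
  have hlog : Real.logb 2 (8 * N) = 3 + Real.logb 2 N := by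
    rw [Real.logb_mul (by norm_num) (by positivity), show (8 : ℝ) = 2 ^ (3 : ℝ) by norm_num,
      Real.logb_rpow (by norm_num) (by norm_num)]
  have h0 : 0 ≤ Real.logb 2 N := Real.logb_nonneg one_lt_two hN'
  have hc := clog_le_logb_add_one hN
  set Λ := Real.logb 2 (8 * N)
  set a := (Nat.clog 2 N : ℝ)
  have hΛ : 3 ≤ Λ := by linarith
  -- `Nat.clog` exceeds the logarithm by at most 1, while the factor 8 contributes 3.
  have ha : a + 1 ≤ Λ - 1 := by linarith
  have hsd : (1 : ℝ) ≤ (s : ℝ) ^ d := one_le_pow₀ hs'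
  have hsd1 : (1 : ℝ) ≤ (s : ℝ) ^ (d + 1) := one_le_pow₀ hs'
  have hV : (N : ℝ) + 2 ≤ (N + 2) * Λ := le_mul_of_one_le_right (by positivity) (by linarith)
  have e1 : ∀ X : ℝ, 0 ≤ X → d * X ≤ (s : ℝ) ^ (d + 1) * d * X := fun X hX => by
    rw [mul_assoc]; exact le_mul_of_one_le_left (by positivity) hsd1
  have e2 : ∀ X : ℝ, 0 ≤ X → (s : ℝ) ^ (d + 1) * X ≤ (s : ℝ) ^ (d + 1) * d * X := fun X hX => by
    rw [mul_assoc]; exact mul_le_mul_of_nonneg_left (le_mul_of_one_le_left hX hd') (by positivity)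
  rw [show (17 * (s : ℝ) ^ (d + 1) * 3 ^ d * d) * (N + 2) * Λ
    = 3 ^ d * ((s : ℝ) ^ (d + 1) * d * (17 * ((N + 2) * Λ))) by ring]
  push_cast
  refine mul_le_mul_of_nonneg_left (max_le (max_le ?_ ?_) (max_le ?_ ?_)) (by positivity)
  · refine le_trans ?_ ((le_mul_of_one_le_left (by positivity) hd').trans (e1 _ (by positivity)))
    nlinarith
  · rw [mul_comm]
    refine le_trans (mul_le_mul_of_nonneg_left ?_ (by positivity)) (e1 _ (by positivity))
    nlinarith
  · refine le_trans (mul_le_mul_of_nonneg_left ?_ (by positivity)) (e1 _ (by positivity))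
    nlinarith
  · refine le_trans ?_ (e2 _ (by positivity))
    rw [pow_succ, mul_assoc ((s : ℝ) ^ d)]
    refine mul_le_mul_of_nonneg_left (max_le ?_ ?_) (by positivity)
    · calc 6 * (N : ℝ) + 20 + 2 * s ≤ s * (6 * N + 22) := by nlinarith
        _ ≤ _ := mul_le_mul_of_nonneg_left (by nlinarith) (by positivity)
    · calc (s : ℝ) * (a + 1) * (6 * N + 15) + 8 ≤ s * ((Λ - 1) * (6 * N + 15) + 8) := by
            have : (a + 1) * (6 * (N : ℝ) + 15) ≤ (Λ - 1) * (6 * N + 15) :=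
              mul_le_mul_of_nonneg_right ha (by positivity)
            nlinarith
        _ ≤ _ := mul_le_mul_of_nonneg_left (by nlinarith) (by positivity)

theorem depth_le {d s L : ℕ} (hs : 1 ≤ s) (hL : 1 ≤ L) :
    ((1 + (2 * L + 2 + (s * (s * (Nat.clog 2 L + 1) + 1) + 2 * (Nat.clog 2 L + 1) * (6 * L + 3))) +
      2 * d : ℕ) : ℝ) ≤ (18 * (s : ℝ) ^ 2) * (L + 2) * Real.logb 2 (4 * L) + 2 * d := by
  have hL' : (1 : ℝ) ≤ L := by exact_mod_cast hL
  have hs' : (1 : ℝ) ≤ s := by exact_mod_cast hs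
  have hlog : Real.logb 2 (4 * L) = 2 + Real.logb 2 L := by
    rw [Real.logb_mul (by norm_num) (by positivity), show (4 : ℝ) = 2 ^ (2 : ℝ) by norm_num,
      Real.logb_rpow (by norm_num) (by norm_num)]
  have h0 : 0 ≤ Real.logb 2 L := Real.logb_nonneg one_lt_two hL'
  have hc := clog_le_logb_add_one hL
  set Λ := Real.logb 2 (4 * L)
  push_cast
  set b := (Nat.clog 2 L : ℝ)
  have hΛ : 2 ≤ Λ := by linarith
  have hb : b + 1 ≤ Λ := by linarith
  have hs2 : (s : ℝ) ≤ s ^ 2 := by nlinarith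
  have hs3 : (1 : ℝ) ≤ s ^ 2 := by nlinarith
  have h1 : (s : ℝ) * (s * (b + 1) + 1) ≤ s ^ 2 * (2 * Λ) := by
    have : (s : ℝ) ^ 2 * (b + 1) ≤ s ^ 2 * Λ := by gcongr
    have : (s : ℝ) ^ 2 * 1 ≤ s ^ 2 * Λ := by gcongr; linarith
    nlinarith
  have h2 : 1 + (2 * (L : ℝ) + 2) + 2 * (b + 1) * (6 * L + 3) ≤ Λ * (14 * L + 8) := by
    have : (b + 1) * (6 * (L : ℝ) + 3) ≤ Λ * (6 * L + 3) := by gcongr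
    nlinarith
  have h3 : Λ * (14 * L + 8) ≤ s ^ 2 * (Λ * (14 * L + 8)) :=
    le_mul_of_one_le_left (by positivity) hs3
  have h4 : (s : ℝ) ^ 2 * (2 * Λ) + s ^ 2 * (Λ * (14 * L + 8)) ≤ 18 * s ^ 2 * (L + 2) * Λ := by
    have : (0 : ℝ) ≤ s ^ 2 * Λ := by positivity
    nlinarith
  linarith

/-- The three error terms of the construction, compared with the rate `(N * L)^(-2s/d)`. -/
theorem rate_bounds {d s N L K : ℕ} (hd : 1 ≤ d) (hN : 1 ≤ N) (hL : 1 ≤ L) (hK : 1 ≤ K)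
    (h : (N : ℝ) ^ (2 / d : ℝ) * (L : ℝ) ^ (2 / d : ℝ) ≤ 8 * K) :
    let R := (N : ℝ) ^ (-(2 * (s : ℝ) / d)) * (L : ℝ) ^ (-(2 * (s : ℝ) / d))
    (1 / 2 : ℝ) ^ (2 * (Nat.clog 2 L + 1) * (s * (Nat.clog 2 N + 1))) ≤ R ∧
      (1 / ((N + 1 : ℕ) : ℝ) ^ 2) ^ (s * (Nat.clog 2 L + 1)) ≤ R ∧
      (1 / (K : ℝ)) ^ s ≤ 8 ^ s * R := by
  intro R
  have hN' : (1 : ℝ) ≤ N := by exact_mod_cast hN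
  have hL' : (1 : ℝ) ≤ L := by exact_mod_cast hL
  have hK' : (0 : ℝ) < K := by exact_mod_cast hK
  obtain ⟨n1, n2⟩ := rpow_le_two_pow_clog (s := s) hd hN
  obtain ⟨-, l2⟩ := rpow_le_two_pow_clog (s := s) hd hL
  set X := (N : ℝ) ^ (2 * (s : ℝ) / d)
  set Y := (L : ℝ) ^ (2 * (s : ℝ) / d)
  have hX : 0 < X := by positivity
  have hY : 0 < Y := by positivity
  have hR : R = 1 / (X * Y) := by
    simp only [R]
    rw [Real.rpow_neg (by positivity), Real.rpow_neg (by positivity), ← mul_inv, one_div]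
  rw [hR]
  refine ⟨?_, ?_, ?_⟩
  · rw [one_div_pow]
    refine one_div_le_one_div_of_le (by positivity) ?_
    calc X * Y ≤ 2 ^ (Nat.clog 2 N * (2 * s)) * 2 ^ (Nat.clog 2 L * (2 * s)) := by gcongr
      _ = 2 ^ (Nat.clog 2 N * (2 * s) + Nat.clog 2 L * (2 * s)) := (pow_add _ _ _).symm
      _ ≤ _ := by
        refine pow_le_pow_right₀ one_le_two ?_
        -- The product of the two logarithms dominates their sum; the remaining terms are dropped.
        have : 2 * (Nat.clog 2 L + 1) * (s * (Nat.clog 2 N + 1))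
          = Nat.clog 2 N * (2 * s) + Nat.clog 2 L * (2 * s)
            + (2 * s * (Nat.clog 2 L * Nat.clog 2 N) + 2 * s) := by ring
        omega
  · rw [one_div_pow]
    refine one_div_le_one_div_of_le (by positivity) ?_
    rw [← pow_mul, show 2 * (s * (Nat.clog 2 L + 1)) = 2 * s + Nat.clog 2 L * (2 * s) by ring,
      pow_add]
    -- The base `N + 1` is at least `N` and at least 2: `2 * s` factors absorb the power of `N`, the
    -- others that of `L`.
    refine mul_le_mul (n1.trans ?_) (l2.trans ?_) hY.le (by positivity)
    · gcongr; omega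
    · gcongr; norm_cast; omega
  · have e : X * Y = ((N : ℝ) ^ (2 / d : ℝ) * (L : ℝ) ^ (2 / d : ℝ)) ^ s := by
      rw [mul_pow, ← Real.rpow_mul_natCast (by positivity), ← Real.rpow_mul_natCast (by positivity),
        div_mul_eq_mul_div]
    have h1 := pow_le_pow_left₀ (by positivity) h s
    rw [← e, mul_pow] at h1
    rw [one_div_pow, mul_one_div, div_le_div_iff₀ (by positivity) (by positivity), one_mul]
    exact h1

end Rates

end ReLUApprox

/-! ### Assembly -/

theorem theorem1 (d s : ℕ) (hd : 1 ≤ d) (hs : 1 ≤ s) (f : (Fin d → ℝ) → ℝ)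
    (hf : ContDiffOn ℝ (s : WithTop ℕ∞) f (ReLUApprox.unitCube d))
    (N L : ℕ) (hN : 1 ≤ N) (hL : 1 ≤ L) :
    ∃ φ : (Fin d → ℝ) → ℝ,
      ReLUApprox.IsImplementedBy φ
        ((17 * (s : ℝ) ^ (d + 1) * 3 ^ d * d) * (N + 2) * Real.logb 2 (8 * N))
        ((18 * (s : ℝ) ^ 2) * (L + 2) * Real.logb 2 (4 * L) + 2 * d) ∧
      ∀ x ∈ ReLUApprox.unitCube d,
        |φ x - f x| ≤ (85 * ((s : ℝ) + 1) ^ d * 8 ^ s) * ReLUApprox.csNorm s f *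
          (N : ℝ) ^ (-(2 * (s : ℝ) / d)) * (L : ℝ) ^ (-(2 * (s : ℝ) / d)) := by
  open ReLUApprox in
  obtain ⟨K, hK, hKd, hKR, hdig⟩ := exists_mesh hd hN hL
  obtain ⟨r1, r2, r3⟩ := rate_bounds (s := s) hd hN hL hK hKR
  set R := (N : ℝ) ^ (-(2 * (s : ℝ) / d)) * (L : ℝ) ^ (-(2 * (s : ℝ) / d)) with hR
  have hN' : (0 : ℝ) < N := by exact_mod_cast hN
  have hL' : (0 : ℝ) < L := by exact_mod_cast hL
  have hR0 : 0 < R := by positivity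
  have hnorm : ∀ x ∈ unitCube d, |f x| ≤ csNorm s f := fun x hx => by
    have := abs_mixedDeriv_le_csNorm hf (α := fun _ => 0) (by simp) hx
    rwa [show mixedDeriv (fun _ : Fin d => 0) f = f from listDeriv_zero _ f] at this
  have hC0 : 0 ≤ csNorm s f := (abs_nonneg _).trans (hnorm 0 (mem_unitCube.2 (by simp)))
  simp only [mul_assoc _ ((N : ℝ) ^ (-(2 * (s : ℝ) / d)))]
  rw [← hR]
  rcases hC0.eq_or_lt with hC | hC
  -- The extension needs a positive `τ`, taken proportional to the norm; if the norm is 0, so is `f`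
  -- on the cube.
  · refine ⟨fun _ => 0, (NN.const (w := 0) (ℓ := 0) 0).isImplementedBy
      ((Nat.cast_le.2 (Nat.zero_le _)).trans (width_le hd hs hN))
      ((Nat.cast_le.2 (Nat.zero_le _)).trans (depth_le hs hL)), fun x hx => ?_⟩
    rw [← hC, zero_sub, abs_neg]
    simpa using (hnorm x hx).trans hC.symm.le
  have hτ : 0 < ((s : ℝ) + 1) ^ d * 8 ^ s * (csNorm s f * R) := by positivity
  obtain ⟨φ, nφ, hφ⟩ := exists_extension hf.continuousOn hK
    (W := max (max 3 (2 * d)) (max (d * (2 * N + 12 + 2)) (s ^ d *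
      max (6 * N + 20 + 2 * s) ((s * (Nat.clog 2 N + 1)) * (6 * N + 15) + 8))))
    ((le_max_left _ _).trans (le_max_left _ _)) ((le_max_right _ _).trans (le_max_left _ _)) hτ
    fun δ hδ => by
      -- The number of parallel digits grows with `log N`, that of serial groups and of squaring
      -- layers with `log L`, so that each error is at most a multiple of `R`.
      obtain ⟨φ, nφ, hφ⟩ := exists_approx_on_cells hs hf hN hL hK hKd hdig
        (s * (Nat.clog 2 N + 1)) (2 * (Nat.clog 2 L + 1)) (s * (Nat.clog 2 L + 1)) hδ
      exact ⟨φ, nφ.mono (le_max_right _ _), hφ⟩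
  refine ⟨φ, nφ.isImplementedBy (width_le hd hs hN) (depth_le hs hL), fun x hx =>
    (hφ x hx).trans ?_⟩
  have hs8 : (s : ℝ) + 2 ≤ 3 * 8 ^ s := by
    have h1 : (s : ℝ) ≤ 8 ^ s := by exact_mod_cast (Nat.lt_pow_self (by norm_num)).le
    have h2 : (1 : ℝ) ≤ 8 ^ s := one_le_pow₀ (by norm_num)
    linarith
  have hsd : (s : ℝ) ^ d ≤ (s + 1) ^ d := by gcongr; linarith
  calc _ ≤ ((s : ℝ) + 1) ^ d * (csNorm s f * (2 * R + s * R)) +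
        (s + 1) ^ d * csNorm s f * (8 ^ s * R) + (s + 1) ^ d * 8 ^ s * (csNorm s f * R) := by
        gcongr
    _ = (s + 1) ^ d * (csNorm s f * R) * (s + 2 + 2 * 8 ^ s) := by ring
    -- Here `s + 2 + 2 * 8 ^ s ≤ 5 * 8 ^ s`, so 85 leaves ample room.
    _ ≤ (s + 1) ^ d * (csNorm s f * R) * (85 * 8 ^ s) := by
        gcongr
        have : (0 : ℝ) ≤ 8 ^ s := by positivity
        linarith
    _ = _ := by ring
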